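/- Let $I=[0,1]$, let $\mathrm{Diff}_+(I)$ be the group of orientation-preserving $C^1$ diffeomorphisms of $I$, and let $\mathrm{Aff}_+(\mathbb{R})$ be the group of maps $x\mapsto ax+b$ of $\mathbb{R}$ with $a>0$, $b\in\mathbb{R}$. Let $\Gamma\le \mathrm{Diff}_+(I)$ be an irreducible subgroup, i.e. no point of the open interval $(0,1)$ is fixed by every element of $\Gamma$. Let $N\ge 0$ be an integer such that every non-identity element of $\Gamma$ has at most $N$ fixed points in $(0,1)$. Then $\Gamma$ is isomorphic, as an abstract group, to a subgroup of $\mathrm{Aff}_+(\mathbb{R})$. Moreover, every non-identity element of $\Gamma$ has at most one fixed point in $(0,1)$. -/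

import Mathlib

/-- A self-map of the closed interval `[0, 1]` is continuously differentiable. It is viewed as a
real function on `[0, 1]` (through `projIcc`, whose values off `[0, 1]` play no role), with
one-sided derivatives at the end points. -/
def IsC1OnI (f : unitInterval → unitInterval) : Prop :=
  ContDiffOn ℝ 1 (fun x : ℝ => (f (Set.projIcc (0 : ℝ) 1 zero_le_one x) : ℝ)) (Set.Icc (0 : ℝ) 1)

theorem isC1OnI_id : IsC1OnI (fun x => x) := by
  refine contDiffOn_id.congr fun x hx => ?_
  simp [Set.projIcc_of_mem zero_le_one hx]

theorem IsC1OnI.comp {f g : unitInterval → unitInterval} (hf : IsC1OnI f) (hg : IsC1OnI g) :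
    IsC1OnI (fun x => f (g x)) := by
  have h := ContDiffOn.comp hf hg fun x _ => (g (Set.projIcc (0 : ℝ) 1 zero_le_one x)).2
  refine h.congr fun x _ => ?_
  simp only [Function.comp]
  rw [Set.projIcc_val]

/-- `Diff₊(I)`: the group of orientation preserving `C¹` diffeomorphisms of `I = [0, 1]`, as a
group of homeomorphisms of `I`. -/
def DiffPlusI : Subgroup (unitInterval ≃ₜ unitInterval) where
  carrier := {f | StrictMono f ∧ IsC1OnI f ∧ IsC1OnI f.symm}
  one_mem' := ⟨strictMono_id, isC1OnI_id, isC1OnI_id⟩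
  mul_mem' := fun ha hb => ⟨ha.1.comp hb.1, ha.2.1.comp hb.2.1, hb.2.2.comp ha.2.2⟩
  inv_mem' := by
    intro f hf
    refine ⟨fun x y hxy => ?_, hf.2.2, hf.2.1⟩
    refine hf.1.lt_iff_lt.mp ?_
    change f (f.symm x) < f (f.symm y)
    simpa using hxy

/-- The class `Φ^diff_N`: subgroups of `Diff₊(I)` all of whose non-identity elements have at most
`N` fixed points in the open interval `(0, 1)`. -/
def PhiDiff (N : ℕ) : Set (Subgroup (unitInterval ≃ₜ unitInterval)) :=
  {Γ | Γ ≤ DiffPlusI ∧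
    ∀ g ∈ Γ, g ≠ 1 → {x : unitInterval | 0 < x ∧ x < 1 ∧ g x = x}.encard ≤ N}

/-- A group of homeomorphisms of `I` is irreducible if it has no global fixed point in `(0, 1)`. -/
def IsIrreducibleOnI (Γ : Subgroup (unitInterval ≃ₜ unitInterval)) : Prop :=
  ¬ ∃ x : unitInterval, 0 < x ∧ x < 1 ∧ ∀ g ∈ Γ, g x = x

/-- `Aff₊(ℝ)`: the group of orientation preserving affine homeomorphisms of `ℝ`. -/
def AffPlus : Subgroup (ℝ ≃ₜ ℝ) where
  carrier := {f | ∃ a b : ℝ, 0 < a ∧ ∀ x, f x = a * x + b}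
  one_mem' := ⟨1, 0, one_pos, fun x => by simp⟩
  mul_mem' := by
    rintro f g ⟨a, b, ha, hf⟩ ⟨c, d, hc, hg⟩
    refine ⟨a * c, a * d + b, mul_pos ha hc, fun x => ?_⟩
    change f (g x) = _
    rw [hg, hf]
    ring
  inv_mem' := by
    rintro f ⟨a, b, ha, hf⟩
    refine ⟨a⁻¹, -(a⁻¹ * b), inv_pos.mpr ha, fun x => ?_⟩
    change f.symm x = _
    rw [Homeomorph.symm_apply_eq, hf]
    field_simp
    ring

/-! A nontrivial element has finitely many fixed points, so near 0 it lies strictly above or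
strictly below the identity. Comparing elements near 0 thus gives a bi-invariant total order on Γ
(`exists_germ_order`).

The bound N forces a smallest Archimedean class of positive elements (`exists_minimal_class`): an
infinite descending chain of classes would yield an element crossing the diagonal more than N times.
Let f lie in this class and let K be the convex subgroup it generates. K is normal and Archimedean,
so Hölder's theorem embeds it in ℝ by τ, and conjugation by g multiplies τ by some `mult g` > 0. If
`mult g` = 1, then g commutes with f, and `not_commute_of_pow_lt` puts g in K. Hence Γ is an
extension of a multiplicative group of scalars by translations, and a crossed homomorphism extending
τ makes it affine (`exists_cocycle`).

For the fixed point bound, nontrivial elements of K act freely on (0,1): otherwise a finite fixed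
set would be invariant under Γ. Suppose `mult g` ≠ 1 and g fixes a < b. After passing to a power of
g or its inverse, `mult g` ≥ 2. Each positive element of K moves a to b or beyond, so suitable
images of [a,b] have disjoint interiors. Binary words in K give 2^n such images near 1. Derivative
estimates at 1 make their total length exceed that of the interval containing them (`eq_of_fixed`).
-/

section BiorderedGroups

/-! ### Archimedean bi-ordered groups and Hölder's theorem -/

variable {A : Type*} [Group A] [LinearOrder A] [MulLeftMono A] [MulRightMono A]

theorem exists_zpow_le_lt_zpow {d : A} (hd : 1 < d) (harch : ∀ y : A, ∃ n : ℕ, y ≤ d ^ n) (x : A) :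
    ∃ m : ℤ, d ^ m ≤ x ∧ x < d ^ (m + 1) := by
  obtain ⟨n, hn⟩ := harch x
  obtain ⟨k, hk⟩ := harch x⁻¹
  obtain ⟨m, hm, hmax⟩ := Int.exists_greatest_of_bdd (P := fun m : ℤ => d ^ m ≤ x)
    ⟨n, fun z hz => by
      by_contra! h
      obtain ⟨k, rfl⟩ : ∃ k : ℕ, z = n + (k + 1 : ℕ) := ⟨(z - n - 1).toNat, by omega⟩
      rw [zpow_add, zpow_natCast, zpow_natCast] at hz
      exact absurd ((lt_mul_of_one_lt_right' _ (one_lt_pow' hd k.succ_ne_zero)).trans_le hz)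
        (not_lt.mpr hn)⟩
    ⟨-k, by simpa using inv_le'.mp hk⟩
  refine ⟨m, hm, ?_⟩
  by_contra! h
  have := hmax _ h
  omega

theorem exists_sq_le_of_not_least (h : ∀ e : A, 1 < e → ∃ x, 1 < x ∧ x < e) {c : A} (hc : 1 < c) :
    ∃ d : A, 1 < d ∧ d * d ≤ c := by
  obtain ⟨e, he, hec⟩ := h c hc
  rcases le_total (e * e) c with h1 | h1
  · exact ⟨e, he, h1⟩
  · refine ⟨c * e⁻¹, by simpa [lt_mul_inv_iff_mul_lt] using hec, ?_⟩
    have h2 : c * e⁻¹ ≤ e := mul_inv_le_iff_le_mul.mpr h1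
    calc c * e⁻¹ * (c * e⁻¹) ≤ c * e⁻¹ * e := by gcongr
      _ = c := by group

/-- If there is a least element above 1, it generates the group. Otherwise a commutator c > 1
dominates some d * d with d > 1; bracketing x and y between consecutive powers of d shows that x * y
and y * x differ by less than d * d, a contradiction. -/
theorem commute_of_archimedean (harch : ∀ x y : A, 1 < x → ∃ n : ℕ, y ≤ x ^ n) (x y : A) :
    x * y = y * x := by
  by_cases h : ∀ e : A, 1 < e → ∃ z, 1 < z ∧ z < e
  · have key : ∀ x y : A, ¬ y * x < x * y := by
      intro x y hlt
      have hc : 1 < x * y * (y * x)⁻¹ := by rwa [lt_mul_inv_iff_mul_lt, one_mul]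
      obtain ⟨d, hd, hdc⟩ := exists_sq_le_of_not_least h hc
      obtain ⟨m, hm, hm'⟩ := exists_zpow_le_lt_zpow hd (fun y => harch d y hd) x
      obtain ⟨n, hn, hn'⟩ := exists_zpow_le_lt_zpow hd (fun y => harch d y hd) y
      have h1 : x * y < d ^ (m + 1) * d ^ (n + 1) := mul_lt_mul_of_lt_of_lt hm' hn'
      have h2 : d ^ n * d ^ m ≤ y * x := mul_le_mul' hn hm
      have h3 : d * d * (y * x) ≤ x * y := le_mul_inv_iff_mul_le.mp hdc
      have h4 : d * d * (d ^ n * d ^ m) ≤ x * y := (mul_le_mul_right h2 _).trans h3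
      refine absurd (h4.trans_lt h1) (not_lt.mpr (le_of_eq ?_))
      simp only [← zpow_add, ← pow_two, ← zpow_natCast]
      congr 1
      push_cast
      ring
    exact le_antisymm (not_lt.mp (key x y)) (not_lt.mp (key y x))
  · push Not at h
    obtain ⟨e, he, hmin⟩ := h
    have key : ∀ x : A, ∃ m : ℤ, x = e ^ m := by
      intro x
      obtain ⟨m, hm, hm'⟩ := exists_zpow_le_lt_zpow he (fun y => harch e y he) x
      refine ⟨m, ?_⟩
      by_contra hne
      have h1 : 1 < (e ^ m)⁻¹ * x := by
        simpa [lt_inv_mul_iff_mul_lt] using lt_of_le_of_ne hm (Ne.symm hne)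
      have h2 := hmin _ h1
      rw [le_inv_mul_iff_mul_le, ← zpow_add_one] at h2
      exact absurd hm' (not_lt.mpr h2)
    obtain ⟨m, rfl⟩ := key x
    obtain ⟨n, rfl⟩ := key y
    exact (Commute.refl e).zpow_zpow m n

/-- Hölder's theorem. -/
theorem exists_strictMono_real_of_archimedean
    (harch : ∀ x y : A, 1 < x → ∃ n : ℕ, y ≤ x ^ n) :
    ∃ τ : A → ℝ, (∀ x y, τ (x * y) = τ x + τ y) ∧ StrictMono τ := by
  let _ : CommGroup A := { ‹Group A› with mul_comm := commute_of_archimedean harch }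
  have _ : IsOrderedMonoid A := { mul_le_mul_left := fun a b h c => mul_le_mul_left h c }
  have _ : Archimedean (Additive A) := ⟨fun x y hy => harch y.toMul x.toMul hy⟩
  obtain ⟨F, hF⟩ := Archimedean.exists_orderAddMonoidHom_real_injective (Additive A)
  refine ⟨fun x => F (Additive.ofMul x), fun x y => F.map_add' _ _, fun x y hxy => ?_⟩
  exact F.monotone'.strictMono_of_injective hF (Additive.ofMul_lt.mpr hxy)

omit [MulLeftMono A] [MulRightMono A] in
-- The ratio φ x / φ f is located among the rationals p/q by comparing x ^ q with f ^ p. This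
-- depends only on the order, so ψ gives the same ratio.
theorem eq_mul_of_strictMono {φ ψ : A → ℝ} (hφ : ∀ x y, φ (x * y) = φ x + φ y)
    (hψ : ∀ x y, ψ (x * y) = ψ x + ψ y) (mφ : StrictMono φ) (mψ : StrictMono ψ) {f : A}
    (hf : 1 < f) (x : A) : φ x = φ f / ψ f * ψ x := by
  have one : ∀ {χ : A → ℝ}, (∀ x y, χ (x * y) = χ x + χ y) → χ 1 = 0 := by
    intro χ h
    simpa using h 1 1
  have zpow : ∀ {χ : A → ℝ}, (∀ x y, χ (x * y) = χ x + χ y) → ∀ (x : A) (n : ℤ),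
      χ (x ^ n) = n * χ x := by
    intro χ h x n
    let F : A →* Multiplicative ℝ :=
      { toFun := fun x => Multiplicative.ofAdd (χ x)
        map_one' := by rw [one h]; rfl
        map_mul' := fun x y => by rw [h]; rfl }
    have := map_zpow F x n
    have h2 := congrArg Multiplicative.toAdd this
    simpa [F] using h2
  have pφ : 0 < φ f := by simpa [one hφ] using mφ hf
  have pψ : 0 < ψ f := by simpa [one hψ] using mψ hf
  suffices φ x / φ f = ψ x / ψ f by
    field_simp at this ⊢
    linarith
  have key : ∀ {φ ψ : A → ℝ}, (∀ x y, φ (x * y) = φ x + φ y) → (∀ x y, ψ (x * y) = ψ x + ψ y) →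
      StrictMono φ → StrictMono ψ → 0 < φ f → 0 < ψ f → ¬ φ x / φ f < ψ x / ψ f := by
    intro φ ψ hφ hψ mφ mψ pφ pψ hlt
    obtain ⟨q, hq1, hq2⟩ := exists_rat_btwn hlt
    have hd : (0 : ℝ) < q.den := by exact_mod_cast q.den_pos
    have hq : (q : ℝ) = q.num / q.den := by exact_mod_cast (Rat.num_div_den q).symm
    rw [hq, div_lt_div_iff₀ pφ hd] at hq1
    rw [hq, div_lt_div_iff₀ hd pψ] at hq2
    have h1 : x ^ (q.den : ℤ) < f ^ q.num := by
      rw [← mφ.lt_iff_lt, zpow hφ, zpow hφ]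
      push_cast
      linarith
    have h2 := mψ h1
    rw [zpow hψ, zpow hψ] at h2
    push_cast at h2
    linarith
  exact le_antisymm (not_lt.mp (key hψ hφ mψ mφ pψ pφ)) (not_lt.mp (key hφ hψ mφ mψ pφ pψ))

end BiorderedGroups

/-- A normal subgroup `K` on which `tau` is an order embedding into `ℝ`, multiplied by `mult g`
under conjugation by `g`, and which is the kernel of `mult`. -/
structure TranslationData (G : Type*) [Group G] [LinearOrder G] where
  K : Subgroup G
  tau : G → ℝ
  mult : G → ℝ
  tau_mul : ∀ x ∈ K, ∀ y ∈ K, tau (x * y) = tau x + tau y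
  tau_lt : ∀ x ∈ K, ∀ y ∈ K, x < y → tau x < tau y
  mult_pos : ∀ g, 0 < mult g
  mult_mul : ∀ g h, mult (g * h) = mult g * mult h
  conj_mem : ∀ g, ∀ x ∈ K, g * x * g⁻¹ ∈ K
  tau_conj : ∀ g, ∀ x ∈ K, tau (g * x * g⁻¹) = mult g * tau x
  mem_of_mult_eq_one : ∀ g, mult g = 1 → g ∈ K
  exists_one_lt : ∃ f ∈ K, 1 < f

/-! ### Translation data from a minimal Archimedean class -/

section BiorderedGroups

variable {G : Type*} [Group G] [LinearOrder G] [MulLeftMono G] [MulRightMono G]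

theorem conj_lt_conj (g : G) {x y : G} (h : x < y) : g * x * g⁻¹ < g * y * g⁻¹ := by
  gcongr

theorem one_lt_conj (g : G) {x : G} (h : 1 < x) : 1 < g * x * g⁻¹ := by
  simpa using conj_lt_conj g h

/-- The convex subgroup generated by `f`. -/
def convexHullSubgroup (f : G) : Subgroup G where
  carrier := {x | ∃ n : ℕ, x ≤ f ^ n ∧ x⁻¹ ≤ f ^ n}
  one_mem' := ⟨0, by simp⟩
  mul_mem' := by
    rintro x y ⟨m, hm, hm'⟩ ⟨n, hn, hn'⟩
    refine ⟨m + n, ?_, ?_⟩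
    · rw [pow_add]; exact mul_le_mul' hm hn
    · rw [mul_inv_rev, add_comm, pow_add]; exact mul_le_mul' hn' hm'
  inv_mem' := by
    rintro x ⟨n, h1, h2⟩
    exact ⟨n, h2, by simpa using h1⟩

theorem conj_mem_convexHullSubgroup {f : G}
    (hn : ∀ g : G, ∃ n : ℕ, g * f * g⁻¹ ≤ f ^ n) (g : G) {x : G}
    (hx : x ∈ convexHullSubgroup f) : g * x * g⁻¹ ∈ convexHullSubgroup f := by
  obtain ⟨m, h1, h2⟩ := hx
  obtain ⟨n, h⟩ := hn g
  have key : ∀ y : G, y ≤ f ^ m → g * y * g⁻¹ ≤ f ^ (n * m) := fun y hy =>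
    calc g * y * g⁻¹ ≤ g * f ^ m * g⁻¹ := by gcongr
      _ = (g * f * g⁻¹) ^ m := (conj_pow).symm
      _ ≤ (f ^ n) ^ m := pow_le_pow_left' h m
      _ = f ^ (n * m) := (pow_mul _ _ _).symm
  refine ⟨n * m, key x h1, ?_⟩
  have : (g * x * g⁻¹)⁻¹ = g * x⁻¹ * g⁻¹ := by group
  rw [this]
  exact key _ h2

/-- Minimality of f makes its convex hull Archimedean, and applied to conjugates of f it makes the
hull normal. Conjugation preserves the order, so by uniqueness in Hölder's theorem it rescales τ. -/
theorem exists_translationData {f : G} (hf : 1 < f) (hmin : ∀ x : G, 1 < x → ∃ n : ℕ, f ≤ x ^ n)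
    (hcomm : ∀ g : G, (∀ n : ℕ, f ^ n < g) → ¬ Commute g f) : Nonempty (TranslationData G) := by
  have hn : ∀ g : G, ∃ n : ℕ, g * f * g⁻¹ ≤ f ^ n := by
    intro g
    obtain ⟨n, h⟩ := hmin _ (one_lt_conj g⁻¹ hf)
    refine ⟨n, ?_⟩
    calc g * f * g⁻¹ ≤ g * (g⁻¹ * f * g⁻¹⁻¹) ^ n * g⁻¹ := by gcongr
      _ = f ^ n := by rw [← conj_pow]; group
  set K := convexHullSubgroup f with hK
  have fK : f ∈ K := ⟨1, by simp, by simpa using (inv_le_one'.mpr hf.le).trans hf.le⟩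
  have _ : MulLeftMono K := ⟨fun a b c h => mul_le_mul_right (α := G) h a⟩
  have _ : MulRightMono K := ⟨fun a b c h => mul_le_mul_left (α := G) h a⟩
  have harch : ∀ x y : K, 1 < x → ∃ n : ℕ, y ≤ x ^ n := by
    rintro ⟨x, hx⟩ ⟨y, m, hy, -⟩ h1
    obtain ⟨n, h⟩ := hmin x h1
    refine ⟨n * m, ?_⟩
    change y ≤ x ^ (n * m)
    rw [pow_mul]
    exact hy.trans (pow_le_pow_left' h m)
  obtain ⟨τ, τmul, τmono⟩ := exists_strictMono_real_of_archimedean harch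
  have τone : τ 1 = 0 := by simpa using τmul 1 1
  let c : G → K → K := fun g x => ⟨g * x * g⁻¹, conj_mem_convexHullSubgroup hn g x.2⟩
  have cmul : ∀ g x y, c g (x * y) = c g x * c g y := fun g x y =>
    Subtype.ext (by simp [c, mul_assoc])
  have cmono : ∀ g, StrictMono (c g) := fun g x y h => conj_lt_conj g h
  let F : K := ⟨f, fK⟩
  have hF : 1 < F := hf
  have pF : 0 < τ F := τone ▸ τmono hF
  let μ : G → ℝ := fun g => τ (c g F) / τ F
  have τc : ∀ g x, τ (c g x) = μ g * τ x := fun g x =>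
    eq_mul_of_strictMono (φ := fun x => τ (c g x)) (fun x y => by rw [cmul, τmul]) τmul
      (τmono.comp (cmono g)) τmono hF x
  classical
  let T : G → ℝ := fun x => if h : x ∈ K then τ ⟨x, h⟩ else 0
  have hT : ∀ x : K, T x = τ x := fun x => by simp [T]
  refine ⟨⟨K, T, μ, ?_, ?_, ?_, ?_, ?_, ?_, ?_, f, fK, hf⟩⟩
  · intro x hx y hy
    exact (hT (⟨x, hx⟩ * ⟨y, hy⟩)).trans ((τmul _ _).trans (by rw [← hT, ← hT]))
  · intro x hx y hy hxy
    have := τmono (show (⟨x, hx⟩ : K) < ⟨y, hy⟩ from hxy)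
    rwa [← hT, ← hT] at this
  · intro g
    refine div_pos ?_ pF
    have : 1 < c g F := one_lt_conj g hf
    exact τone ▸ τmono this
  · intro g h
    have h1 : c (g * h) F = c g (c h F) := Subtype.ext (by simp [c, mul_assoc])
    have h2 := τc (g * h) F
    rw [h1, τc, τc] at h2
    exact mul_right_cancel₀ pF.ne' (by linarith)
  · intro g x hx
    exact conj_mem_convexHullSubgroup hn g hx
  · intro g x hx
    exact (hT (c g ⟨x, hx⟩)).trans ((τc g ⟨x, hx⟩).trans (by rw [← hT]))
  -- Since τ is injective on the hull, multiplier 1 means that g commutes with f; then `hcomm`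
  -- bounds both g and its inverse by powers of f.
  · intro g hg
    have h1 : c g F = F := τmono.injective (by rw [τc, hg, one_mul])
    have h2 : Commute g f := mul_inv_eq_iff_eq_mul.mp (congrArg Subtype.val h1)
    have upper : ∀ g : G, Commute g f → ∃ n : ℕ, g ≤ f ^ n := fun g hg => by
      by_contra! h
      exact hcomm g h hg
    obtain ⟨m, hm⟩ := upper g h2
    obtain ⟨n, hn⟩ := upper g⁻¹ h2.inv_left
    exact ⟨m + n, hm.trans (pow_le_pow_right' hf.le (by omega)),
      hn.trans (pow_le_pow_right' hf.le (by omega))⟩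

end BiorderedGroups

/-! ### The affine representation -/

namespace TranslationData

variable {G : Type*} [Group G] [LinearOrder G] (D : TranslationData G)

theorem tau_one : D.tau 1 = 0 := by
  simpa using D.tau_mul 1 D.K.one_mem 1 D.K.one_mem

theorem tau_inv {x : G} (hx : x ∈ D.K) : D.tau x⁻¹ = - D.tau x := by
  have := D.tau_mul x hx x⁻¹ (D.K.inv_mem hx)
  rw [mul_inv_cancel, D.tau_one] at this
  linarith

theorem tau_lt_iff {x y : G} (hx : x ∈ D.K) (hy : y ∈ D.K) : D.tau x < D.tau y ↔ x < y := by
  refine ⟨fun h => ?_, D.tau_lt x hx y hy⟩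
  by_contra! hle
  rcases hle.eq_or_lt with rfl | hlt
  · exact lt_irrefl _ h
  · exact lt_asymm h (D.tau_lt y hy x hx hlt)

theorem tau_injOn {x y : G} (hx : x ∈ D.K) (hy : y ∈ D.K) (h : D.tau x = D.tau y) : x = y := by
  rcases lt_trichotomy x y with hlt | heq | hlt
  · exact absurd h (D.tau_lt x hx y hy hlt).ne
  · exact heq
  · exact absurd h (D.tau_lt y hy x hx hlt).ne'

theorem commute {x y : G} (hx : x ∈ D.K) (hy : y ∈ D.K) : Commute x y :=
  D.tau_injOn (D.K.mul_mem hx hy) (D.K.mul_mem hy hx) (by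
    rw [D.tau_mul x hx y hy, D.tau_mul y hy x hx, add_comm])

theorem tau_pow {x : G} (hx : x ∈ D.K) (n : ℕ) : D.tau (x ^ n) = n * D.tau x := by
  induction n with
  | zero => simp [D.tau_one]
  | succ n ih =>
    rw [pow_succ, D.tau_mul _ (D.K.pow_mem hx n) _ hx, ih]
    push_cast
    ring

theorem mult_one : D.mult 1 = 1 := by
  have h := D.mult_mul 1 1
  rw [mul_one] at h
  exact (mul_right_cancel₀ (D.mult_pos 1).ne' (by linarith)).symm

theorem mult_inv (g : G) : D.mult g⁻¹ = (D.mult g)⁻¹ := by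
  have h := D.mult_mul g⁻¹ g
  rw [inv_mul_cancel, D.mult_one] at h
  exact eq_inv_of_mul_eq_one_left h.symm

theorem mult_pow (g : G) (n : ℕ) : D.mult (g ^ n) = D.mult g ^ n := by
  induction n with
  | zero => simp [D.mult_one]
  | succ n ih => rw [pow_succ, D.mult_mul, ih, pow_succ]

theorem commutator_mem (g h : G) : g * h * g⁻¹ * h⁻¹ ∈ D.K := by
  refine D.mem_of_mult_eq_one _ ?_
  rw [D.mult_mul, D.mult_mul, D.mult_mul, D.mult_inv, D.mult_inv]
  have := (D.mult_pos g).ne'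
  have := (D.mult_pos h).ne'
  field_simp

/-- A crossed homomorphism extending `tau` injectively. -/
theorem exists_cocycle : ∃ β : G → ℝ, (∀ g h, β (g * h) = β g + D.mult g * β h) ∧
    ∀ g, D.mult g = 1 → β g = 0 → g = 1 := by
  by_cases hm : ∀ g, D.mult g = 1
  · have hK : ∀ g, g ∈ D.K := fun g => D.mem_of_mult_eq_one g (hm g)
    refine ⟨D.tau, fun g h => ?_, fun g _ h0 => ?_⟩
    · rw [hm, one_mul, D.tau_mul _ (hK g) _ (hK h)]
    · exact D.tau_injOn (hK g) D.K.one_mem (h0.trans D.tau_one.symm)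
  · push Not at hm
    obtain ⟨c, hc⟩ := hm
    have hc' : D.mult c - 1 ≠ 0 := sub_ne_zero.mpr hc
    -- On K the commutator with c has τ-value (`mult c` - 1) * τ, so the quotient extends τ. It is
    -- defined everywhere because all commutators lie in K.
    refine ⟨fun g => D.tau (c * g * c⁻¹ * g⁻¹) / (D.mult c - 1), fun g h => ?_, fun g h1 h0 => ?_⟩
    · have e : c * (g * h) * c⁻¹ * (g * h)⁻¹
          = (c * g * c⁻¹ * g⁻¹) * (g * (c * h * c⁻¹ * h⁻¹) * g⁻¹) := by group
      simp only []
      rw [e, D.tau_mul _ (D.commutator_mem c g) _ (D.conj_mem g _ (D.commutator_mem c h)),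
        D.tau_conj g _ (D.commutator_mem c h)]
      ring
    · have hg := D.mem_of_mult_eq_one g h1
      simp only [div_eq_zero_iff, hc', or_false] at h0
      rw [D.tau_mul _ (D.conj_mem c g hg) _ (D.K.inv_mem hg), D.tau_conj c g hg,
        D.tau_inv hg] at h0
      have h2 : (D.mult c - 1) * D.tau g = 0 := by linarith
      have h3 := (mul_eq_zero.mp h2).resolve_left hc'
      exact D.tau_injOn hg D.K.one_mem (h3.trans D.tau_one.symm)

/-- The affine homeomorphism `x ↦ a * x + b`. -/
noncomputable def affineHomeo (a : ℝ) (ha : a ≠ 0) (b : ℝ) : ℝ ≃ₜ ℝ where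
  toFun x := a * x + b
  invFun x := a⁻¹ * (x - b)
  left_inv x := by field_simp; ring
  right_inv x := by field_simp; ring
  continuous_toFun := by fun_prop
  continuous_invFun := by fun_prop

theorem exists_mulEquiv_le_affPlus {G : Type*} [Group G] [LinearOrder G]
    (D : TranslationData G) :
    ∃ H : Subgroup (ℝ ≃ₜ ℝ), H ≤ AffPlus ∧ Nonempty (G ≃* H) := by
  obtain ⟨β, hβ, hinj⟩ := D.exists_cocycle
  have hβ1 : β 1 = 0 := by simpa [D.mult_one] using hβ 1 1
  let F : G →* (ℝ ≃ₜ ℝ) :=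
    { toFun := fun g => affineHomeo (D.mult g) (D.mult_pos g).ne' (β g)
      map_one' := by
        ext x
        change D.mult 1 * x + β 1 = x
        rw [D.mult_one, hβ1]; ring
      map_mul' := fun g h => by
        ext x
        change D.mult (g * h) * x + β (g * h) = D.mult g * (D.mult h * x + β h) + β g
        rw [D.mult_mul, hβ]; ring }
  have hF : ∀ g x, F g x = D.mult g * x + β g := fun g x => rfl
  have inj : Function.Injective F := by
    refine (injective_iff_map_eq_one F).mpr fun g hg => ?_
    have h0 : β g = 0 := by
      have : F g 0 = 0 := by rw [hg]; rfl
      simpa [hF] using this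
    have h1 : D.mult g = 1 := by
      have : F g 1 = 1 := by rw [hg]; rfl
      simpa [hF, h0] using this
    exact hinj g h1 h0
  refine ⟨F.range, ?_, ⟨MonoidHom.ofInjective inj⟩⟩
  rintro _ ⟨g, rfl⟩
  exact ⟨D.mult g, β g, D.mult_pos g, hF g⟩

end TranslationData

/-! ### Increasing homeomorphisms and their germs at 0 -/

section IntervalHomeos

theorem strictMono_mem {Γ : Subgroup (unitInterval ≃ₜ unitInterval)} (hΓ : Γ ≤ DiffPlusI)
    (g : Γ) : StrictMono (g : unitInterval ≃ₜ unitInterval) := (hΓ g.2).1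

theorem homeo_zero {f : unitInterval ≃ₜ unitInterval} (hf : StrictMono f) : f 0 = 0 :=
  le_antisymm (by
    obtain ⟨x, hx⟩ := f.surjective 0
    exact (hf.monotone (bot_le : (0 : unitInterval) ≤ x)).trans hx.le) bot_le

theorem homeo_one {f : unitInterval ≃ₜ unitInterval} (hf : StrictMono f) : f 1 = 1 :=
  le_antisymm le_top (by
    obtain ⟨x, hx⟩ := f.surjective 1
    exact hx.ge.trans (hf.monotone (le_top : x ≤ (1 : unitInterval))))

theorem homeo_pos {f : unitInterval ≃ₜ unitInterval} (hf : StrictMono f) {x : unitInterval}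
    (hx : 0 < x) : 0 < f x := homeo_zero hf ▸ hf hx

theorem homeo_lt_one {f : unitInterval ≃ₜ unitInterval} (hf : StrictMono f) {x : unitInterval}
    (hx : x < 1) : f x < 1 := by
  have := hf hx
  rwa [homeo_one hf] at this

theorem homeo_pow_succ (f : unitInterval ≃ₜ unitInterval) (n : ℕ) (x : unitInterval) :
    (f ^ (n + 1)) x = f ((f ^ n) x) := by
  rw [pow_succ']; rfl

theorem homeo_pow_succ_apply (f : unitInterval ≃ₜ unitInterval) (n : ℕ) (x : unitInterval) :
    (f ^ (n + 1)) x = (f ^ n) (f x) := by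
  rw [pow_succ]; rfl

theorem homeo_pow_strictMono {f : unitInterval ≃ₜ unitInterval} (hf : StrictMono f) (n : ℕ) :
    StrictMono (f ^ n : unitInterval ≃ₜ unitInterval) := by
  induction n with
  | zero => exact strictMono_id
  | succ n ih => rw [pow_succ]; exact ih.comp hf

theorem homeo_inv_strictMono {f : unitInterval ≃ₜ unitInterval} (hf : StrictMono f) :
    StrictMono (f⁻¹ : unitInterval ≃ₜ unitInterval) := by
  intro x y hxy
  refine hf.lt_iff_lt.mp ?_
  change f (f.symm x) < f (f.symm y)
  simpa using hxy

@[simp] theorem homeo_inv_apply_self (f : unitInterval ≃ₜ unitInterval) (x : unitInterval) :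
    (f⁻¹ : unitInterval ≃ₜ unitInterval) (f x) = x := f.symm_apply_apply x

@[simp] theorem homeo_apply_inv_self (f : unitInterval ≃ₜ unitInterval) (x : unitInterval) :
    f ((f⁻¹ : unitInterval ≃ₜ unitInterval) x) = x := f.apply_symm_apply x

/-- If the iterates of `w` stay below `x`, they converge to a fixed point of `f`. -/
theorem exists_fixed_of_iterates_le {f : unitInterval ≃ₜ unitInterval} (hf : StrictMono f)
    {w x : unitInterval} (hw : w ≤ f w) (hx : ∀ n : ℕ, (f ^ n) w ≤ x) :
    ∃ c, w ≤ c ∧ c ≤ x ∧ f c = c := by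
  have mono : Monotone fun n : ℕ => (f ^ n) w := by
    refine monotone_nat_of_le_succ fun n => ?_
    rw [homeo_pow_succ_apply]
    exact (homeo_pow_strictMono hf n).monotone hw
  have lim := tendsto_atTop_ciSup mono ⟨1, fun y _ => le_top⟩
  refine ⟨_, ?_, ciSup_le hx, ?_⟩
  · exact le_ciSup (f := fun n : ℕ => (f ^ n) w) ⟨1, fun y _ => le_top⟩ 0
  · have l1 := (f.continuous.tendsto _).comp lim
    have l2 := lim.comp (Filter.tendsto_add_atTop_nat 1)
    refine tendsto_nhds_unique l1 (l2.congr fun n => ?_)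
    exact homeo_pow_succ f n w

theorem exists_lt_pow_apply {f : unitInterval ≃ₜ unitInterval} (hf : StrictMono f)
    {w x : unitInterval} (h : ∀ y, w ≤ y → y ≤ x → y < f y) : ∃ n : ℕ, x < (f ^ n) w := by
  by_contra! hn
  have hwx : w ≤ x := hn 0
  obtain ⟨c, hc1, hc2, hc3⟩ := exists_fixed_of_iterates_le hf (h w le_rfl hwx).le hn
  exact (h c hc1 hc2).ne' hc3

theorem exists_fixed_of_le_of_le {f : unitInterval ≃ₜ unitInterval} {a b : unitInterval}
    (hab : a ≤ b) (h : (a ≤ f a ∧ f b ≤ b) ∨ (f a ≤ a ∧ b ≤ f b)) :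
    ∃ c, a ≤ c ∧ c ≤ b ∧ f c = c := by
  rcases h with h | h
  · obtain ⟨c, hc, hc'⟩ := exists_mem_Icc_isFixedPt f.continuous.continuousOn hab h.1 h.2
    exact ⟨c, hc.1, hc.2, hc'⟩
  · obtain ⟨c, hc, hc'⟩ := isPreconnected_Icc.intermediate_value₂
      (Set.left_mem_Icc.mpr hab) (Set.right_mem_Icc.mpr hab)
      f.continuous.continuousOn continuousOn_id h.1 h.2
    exact ⟨c, hc.1, hc.2, hc'⟩

/-- The fixed points of `f` in the open interval `(0, 1)`. -/
def interiorFixed (f : unitInterval ≃ₜ unitInterval) : Set unitInterval :=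
  {x | 0 < x ∧ x < 1 ∧ f x = x}

/-- `f` is above the identity on a right neighbourhood of `0`. -/
def AboveIdNearZero (f : unitInterval ≃ₜ unitInterval) : Prop :=
  ∃ e : unitInterval, 0 < e ∧ ∀ x, 0 < x → x ≤ e → x < f x

theorem exists_no_fixed_near_zero {f : unitInterval ≃ₜ unitInterval}
    (hfin : (interiorFixed f).Finite) :
    ∃ e : unitInterval, 0 < e ∧ e < 1 ∧ ∀ x, 0 < x → x ≤ e → f x ≠ x := by
  -- Adding the point 1 guarantees a minimum even when there is no interior fixed point.
  have hs : (insert 1 (interiorFixed f)).Finite := hfin.insert 1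
  obtain ⟨m, hm, hmin⟩ := hs.exists_minimalFor id _ ⟨1, Set.mem_insert _ _⟩
  have hm0 : 0 < m := by
    rcases hm with rfl | hm
    · exact zero_lt_one
    · exact hm.1
  obtain ⟨e, he0, hem⟩ := exists_between hm0
  have he1 : e < 1 := hem.trans_le le_top
  refine ⟨e, he0, he1, fun x hx0 hxe hfx => ?_⟩
  have := hmin (j := x) (Or.inr ⟨hx0, hxe.trans_lt he1, hfx⟩) (hxe.trans hem.le)
  exact absurd (this.trans hxe) (not_le.mpr hem)

theorem aboveId_or_inv_aboveId {f : unitInterval ≃ₜ unitInterval} (hf : StrictMono f)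
    (hfin : (interiorFixed f).Finite) : AboveIdNearZero f ∨ AboveIdNearZero f⁻¹ := by
  obtain ⟨e, he0, -, he⟩ := exists_no_fixed_near_zero hfin
  by_cases h : e < f e
  · refine Or.inl ⟨e, he0, fun x hx0 hxe => ?_⟩
    by_contra! hx
    obtain ⟨c, hc1, hc2, hc3⟩ := exists_fixed_of_le_of_le hxe (Or.inr ⟨hx, h.le⟩)
    exact he c (hx0.trans_le hc1) hc2 hc3
  · push Not at h
    have below : ∀ x, 0 < x → x ≤ e → f x < x := by
      intro x hx0 hxe
      by_contra! hx
      obtain ⟨c, hc1, hc2, hc3⟩ := exists_fixed_of_le_of_le hxe (Or.inl ⟨hx, h⟩)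
      exact he c (hx0.trans_le hc1) hc2 hc3
    refine Or.inr ⟨f e, homeo_pos hf he0, fun x hx0 hxe => ?_⟩
    have h1 : (f⁻¹ : unitInterval ≃ₜ unitInterval) x ≤ e := by
      rw [← hf.le_iff_le]; simpa using hxe
    simpa using below _ (homeo_pos (homeo_inv_strictMono hf) hx0) h1

theorem AboveIdNearZero.mul {f g : unitInterval ≃ₜ unitInterval} (hf : AboveIdNearZero f)
    (hg : AboveIdNearZero g) (mf : StrictMono f) : AboveIdNearZero (f * g) := by
  obtain ⟨a, ha, hfa⟩ := hf
  obtain ⟨b, hb, hgb⟩ := hg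
  refine ⟨min a b, lt_min ha hb, fun x hx0 hx => ?_⟩
  calc x < f x := hfa x hx0 (hx.trans (min_le_left _ _))
    _ < f (g x) := mf (hgb x hx0 (hx.trans (min_le_right _ _)))

theorem AboveIdNearZero.conj {f g : unitInterval ≃ₜ unitInterval} (hf : AboveIdNearZero f)
    (mg : StrictMono g) : AboveIdNearZero (g * f * g⁻¹) := by
  obtain ⟨a, ha, hfa⟩ := hf
  refine ⟨g a, homeo_pos mg ha, fun x hx0 hx => ?_⟩
  have h1 : (g⁻¹ : unitInterval ≃ₜ unitInterval) x ≤ a := by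
    rw [← mg.le_iff_le]; simpa using hx
  have := mg (hfa _ (homeo_pos (homeo_inv_strictMono mg) hx0) h1)
  simpa using this

end IntervalHomeos

/-! ### Oscillation measured in iterates of a reference map -/

section Oscillation

/-- At `w`, the map `u` moves points up (`true`) or down (`false`) by at least `R` iterates of `G`,
within `[0, e]`. -/
def Push (G u : unitInterval ≃ₜ unitInterval) (R : ℕ) (e w : unitInterval) : Bool → Prop
  | true => (G ^ R) w ≤ u w ∧ (G ^ R) w ≤ e
  | false => (G ^ R) (u w) ≤ w ∧ (G ^ R) (u w) ≤ e

/-- There are `r` points above `x` at which `u` moves points by at least `R` iterates of `G`, in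
alternating directions. -/
def Oscillates (G u : unitInterval ≃ₜ unitInterval) (R : ℕ) (e : unitInterval) :
    Bool → ℕ → unitInterval → Prop
  | _, 0, _ => True
  | b, r + 1, x => ∃ w, x < w ∧ Push G u R e w b ∧ Oscillates G u R e (!b) r w

variable {G u h : unitInterval ≃ₜ unitInterval} {e : unitInterval}

theorem le_of_apply_le (mG : StrictMono G) (hG : ∀ y, 0 < y → y ≤ e → y < G y) (he : 0 < e)
    {y : unitInterval} (hy : G y ≤ e) : y ≤ e := by
  by_contra! h
  exact absurd ((hG e he le_rfl).trans (mG h)) (not_lt.mpr hy)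

theorem le_pow_apply (mG : StrictMono G) (hG : ∀ y, 0 < y → y ≤ e → y < G y) (he : 0 < e)
    {y : unitInterval} (hy : 0 < y) (n : ℕ) (hn : (G ^ n) y ≤ e) : y ≤ (G ^ n) y := by
  induction n with
  | zero => exact le_rfl
  | succ n ih =>
    rw [homeo_pow_succ] at hn ⊢
    have h1 := le_of_apply_le mG hG he hn
    exact (ih h1).trans (hG _ (homeo_pos (homeo_pow_strictMono mG n) hy) h1).le

theorem lt_pow_succ_apply (mG : StrictMono G) (hG : ∀ y, 0 < y → y ≤ e → y < G y) (he : 0 < e)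
    {y : unitInterval} (hy : 0 < y) (n : ℕ) (hn : (G ^ (n + 1)) y ≤ e) : y < (G ^ (n + 1)) y := by
  rw [homeo_pow_succ] at hn ⊢
  have h1 := le_of_apply_le mG hG he hn
  exact (le_pow_apply mG hG he hy n h1).trans_lt
    (hG _ (homeo_pos (homeo_pow_strictMono mG n) hy) h1)

theorem Oscillates.mono_left {R : ℕ} {b : Bool} {r : ℕ} {x y : unitInterval}
    (H : Oscillates G u R e b r x) (hyx : y ≤ x) : Oscillates G u R e b r y := by
  cases r with
  | zero => trivial
  | succ r =>
    obtain ⟨w, hw, H⟩ := H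
    exact ⟨w, hyx.trans_lt hw, H⟩

theorem Oscillates.inv {R : ℕ} {b : Bool} {r : ℕ} {x : unitInterval} (mu : StrictMono u)
    (H : Oscillates G u R e b r x) : Oscillates G u⁻¹ R e (!b) r (u x) := by
  induction r generalizing b x with
  | zero => trivial
  | succ r ih =>
    obtain ⟨w, hw, hp, H⟩ := H
    refine ⟨u w, mu hw, ?_, ih H⟩
    cases b <;> simpa [Push] using hp

/-- Since h lies between the identity and G on (0, e], composing with h helps upward pushes and
costs downward ones at most one iterate of G. -/
theorem Oscillates.mul {R : ℕ} {b : Bool} {r : ℕ} {x : unitInterval} (mG : StrictMono G)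
    (mu : StrictMono u) (mh : StrictMono h) (he : 0 < e) (hid : ∀ y, 0 < y → y ≤ e → y < h y)
    (hhG : ∀ y, 0 < y → y ≤ e → h y < G y) (H : Oscillates G u (R + 1) e b r x) :
    Oscillates G (h * u) R e b r x := by
  have hG : ∀ y, 0 < y → y ≤ e → y < G y := fun y h0 h1 => (hid y h0 h1).trans (hhG y h0 h1)
  induction r generalizing b x with
  | zero => trivial
  | succ r ih =>
    obtain ⟨w, hw, hp, H⟩ := H
    have hw0 : 0 < w := bot_le.trans_lt hw
    refine ⟨w, hw, ?_, ih H⟩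
    cases b with
    | true =>
      obtain ⟨h1, h2⟩ := hp
      have h3 : (G ^ R) w ≤ e := le_of_apply_le mG hG he (by rwa [← homeo_pow_succ])
      have h0 : 0 < (G ^ R) w := homeo_pos (homeo_pow_strictMono mG R) hw0
      have h4 : (G ^ R) w ≤ (G ^ (R + 1)) w := by
        rw [homeo_pow_succ]; exact (hG _ h0 h3).le
      refine ⟨?_, h3⟩
      calc (G ^ R) w ≤ (G ^ (R + 1)) w := h4
        _ ≤ h ((G ^ (R + 1)) w) := (hid _ (h0.trans_le h4) h2).le
        _ ≤ h (u w) := mh.monotone h1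
    | false =>
      obtain ⟨h1, h2⟩ := hp
      have h0 : 0 < u w := homeo_pos mu hw0
      have h3 : u w ≤ e := (le_pow_apply mG hG he h0 _ h2).trans h2
      have h4 : (G ^ R) (h (u w)) ≤ (G ^ (R + 1)) (u w) := by
        rw [homeo_pow_succ_apply]
        exact (homeo_pow_strictMono mG R).monotone (hhG _ h0 h3).le
      exact ⟨h4.trans h1, h4.trans h2⟩

theorem le_pow_of_le_apply (mu : StrictMono u) {w : unitInterval} (hw : w ≤ u w) (k : ℕ) :
    w ≤ (u ^ k) w := by
  induction k with
  | zero => exact le_rfl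
  | succ k ih => rw [homeo_pow_succ]; exact hw.trans (mu.monotone ih)

theorem pow_apply_le_of_apply_le (mu : StrictMono u) {w : unitInterval} (hw : u w ≤ w) (k : ℕ) :
    (u ^ k) w ≤ w := by
  induction k with
  | zero => exact le_rfl
  | succ k ih => rw [homeo_pow_succ]; exact (mu.monotone ih).trans hw

theorem Oscillates.pow_succ {R : ℕ} {b : Bool} {r : ℕ} {x : unitInterval} (mG : StrictMono G)
    (mu : StrictMono u) (he : 0 < e) (hG : ∀ y, 0 < y → y ≤ e → y < G y)
    (H : Oscillates G u R e b r x) (k : ℕ) : Oscillates G (u ^ (k + 1)) R e b r x := by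
  induction r generalizing b x with
  | zero => trivial
  | succ r ih =>
    obtain ⟨w, hw, hp, H⟩ := H
    have hw0 : 0 < w := bot_le.trans_lt hw
    refine ⟨w, hw, ?_, ih H⟩
    cases b with
    | true =>
      obtain ⟨h1, h2⟩ := hp
      have h3 : w ≤ u w := (le_pow_apply mG hG he hw0 R h2).trans h1
      have h4 : u w ≤ (u ^ (k + 1)) w := by
        rw [homeo_pow_succ]
        exact mu.monotone (le_pow_of_le_apply mu h3 k)
      exact ⟨h1.trans h4, h2⟩
    | false =>
      obtain ⟨h1, h2⟩ := hp
      have h3 : u w ≤ w := (le_pow_apply mG hG he (homeo_pos mu hw0) R h2).trans h1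
      have h4 : (u ^ (k + 1)) w ≤ u w := by
        rw [homeo_pow_succ]
        exact mu.monotone (pow_apply_le_of_apply_le mu h3 k)
      have h5 := (homeo_pow_strictMono mG R).monotone h4
      exact ⟨h5.trans h1, h5.trans h2⟩

/-- Inverting u reverses its pushes, and multiplying by h costs one unit of R. As h * u⁻¹ is above
the identity near 0, a high power of it pushes up a point close to 0, adding one oscillation before
the others; the older pushes survive taking powers. -/
theorem Oscillates.step {R r : ℕ} {x : unitInterval} (mG : StrictMono G)
    (mu : StrictMono u) (mh : StrictMono h) (he : 0 < e) (hid : ∀ y, 0 < y → y ≤ e → y < h y)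
    (hhG : ∀ y, 0 < y → y ≤ e → h y < G y) (hx : 0 < x)
    (H : Oscillates G u (R + 1) e true r x) (hpos : AboveIdNearZero (h * u⁻¹)) :
    ∃ (k : ℕ) (y : unitInterval), 0 < y ∧
      Oscillates G ((h * u⁻¹) ^ (k + 1)) R e true (r + 1) y := by
  have hG : ∀ y, 0 < y → y ≤ e → y < G y := fun y h0 h1 => (hid y h0 h1).trans (hhG y h0 h1)
  have mv : StrictMono (h * u⁻¹ : unitInterval ≃ₜ unitInterval) :=
    mh.comp (homeo_inv_strictMono mu)
  have H1 : Oscillates G (h * u⁻¹) R e false r (u x) :=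
    (H.inv mu).mul mG (homeo_inv_strictMono mu) mh he hid hhG
  obtain ⟨d, hd, hv⟩ := hpos
  set z := min e (min d (u x)) with hz
  have hz0 : 0 < z := lt_min he (lt_min hd (homeo_pos mu hx))
  have hze : z ≤ e := min_le_left _ _
  have hzd : z ≤ d := (min_le_right _ _).trans (min_le_left _ _)
  have hzu : z ≤ u x := (min_le_right _ _).trans (min_le_right _ _)
  have mGR := homeo_pow_strictMono mG R
  -- The new point is chosen so that its R-th G-iterate is exactly z, which lies in the range where
  -- h * u⁻¹ is above the identity and below the old oscillations.
  set w := ((G ^ R)⁻¹ : unitInterval ≃ₜ unitInterval) z with hw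
  have hGw : (G ^ R) w = z := homeo_apply_inv_self _ _
  have hw0 : 0 < w := homeo_pos (homeo_inv_strictMono mGR) hz0
  have hwz : w ≤ z := hGw ▸ le_pow_apply mG hG he hw0 R (hGw.le.trans hze)
  obtain ⟨k, hk⟩ := exists_lt_pow_apply mv (w := w) (x := z) fun y hy1 hy2 =>
    hv y (hw0.trans_le hy1) (hy2.trans hzd)
  obtain ⟨y, hy0, hyw⟩ := exists_between hw0
  refine ⟨k, y, hy0, w, hyw, ⟨?_, hGw.le.trans hze⟩, ?_⟩
  · rw [hGw, homeo_pow_succ_apply]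
    exact hk.le.trans ((homeo_pow_strictMono mv k).monotone (hv w hw0 (hwz.trans hzd)).le)
  · exact (H1.pow_succ mG mv he hG k).mono_left (hwz.trans hzu)

theorem Push.sign {R : ℕ} {w : unitInterval} {b : Bool} (mG : StrictMono G) (mu : StrictMono u)
    (he : 0 < e) (hG : ∀ y, 0 < y → y ≤ e → y < G y) (hw : 0 < w)
    (H : Push G u (R + 1) e w b) : if b then w < u w else u w < w := by
  cases b with
  | true => simpa using (lt_pow_succ_apply mG hG he hw R H.2).trans_le H.1
  | false => simpa using (lt_pow_succ_apply mG hG he (homeo_pos mu hw) R H.2).trans_le H.1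

/-- Consecutive pushes have opposite signs, so a fixed point lies strictly between them. One unit of
R is kept to make the signs strict. -/
theorem Oscillates.le_encard {R r : ℕ} {x : unitInterval} {b : Bool} (mG : StrictMono G)
    (mu : StrictMono u) (he : 0 < e) (hG : ∀ y, 0 < y → y ≤ e → y < G y)
    (H : Oscillates G u (R + 1) e b (r + 1) x) :
    ∃ w, x < w ∧ (if b then w < u w else u w < w) ∧
      (r : ℕ∞) ≤ {y | w < y ∧ y < 1 ∧ u y = y}.encard := by
  induction r generalizing b x with
  | zero =>
    obtain ⟨w, hw, hp, -⟩ := H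
    exact ⟨w, hw, hp.sign mG mu he hG (bot_le.trans_lt hw), by simp⟩
  | succ r ih =>
    obtain ⟨w, hw, hp, H⟩ := H
    have hs := hp.sign mG mu he hG (bot_le.trans_lt hw)
    obtain ⟨v, hv, hsv, hr⟩ := ih H
    refine ⟨w, hw, hs, ?_⟩
    obtain ⟨c, hc1, hc2, hc3⟩ : ∃ c, w ≤ c ∧ c ≤ v ∧ u c = c := by
      refine exists_fixed_of_le_of_le hv.le ?_
      cases b
      · exact Or.inr ⟨by simpa using hs.le, by simpa using hsv.le⟩
      · exact Or.inl ⟨by simpa using hs.le, by simpa using hsv.le⟩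
    have hcw : c ≠ w := by
      rintro rfl
      cases b <;> simp [hc3] at hs
    have hcv : c ≠ v := by
      rintro rfl
      cases b <;> simp [hc3] at hsv
    have hc2' : c < v := lt_of_le_of_ne hc2 hcv
    have hsub : insert c {y | v < y ∧ y < 1 ∧ u y = y} ⊆ {y | w < y ∧ y < 1 ∧ u y = y} := by
      rintro y (rfl | ⟨h1, h2⟩)
      · exact ⟨lt_of_le_of_ne hc1 hcw.symm, hc2'.trans_le le_top, hc3⟩
      · exact ⟨hv.trans h1, h2⟩
    calc ((r + 1 : ℕ) : ℕ∞) = (r : ℕ∞) + 1 := by push_cast; rfl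
      _ ≤ {y | v < y ∧ y < 1 ∧ u y = y}.encard + 1 := by gcongr
      _ = (insert c {y | v < y ∧ y < 1 ∧ u y = y}).encard :=
        (Set.encard_insert_of_notMem fun h => absurd h.1 (not_lt.mpr hc2)).symm
      _ ≤ _ := Set.encard_le_encard hsub

end Oscillation

/-! ### The germ order and its smallest Archimedean class -/

section GermOrder

variable {Γ : Subgroup (unitInterval ≃ₜ unitInterval)}

theorem exists_germ_order (hΓ : Γ ≤ DiffPlusI)
    (hfin : ∀ g ∈ Γ, g ≠ 1 → (interiorFixed g).Finite) :
    ∃ _ : LinearOrder Γ, MulLeftMono Γ ∧ MulRightMono Γ ∧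
      ∀ a : Γ, 1 < a ↔ AboveIdNearZero (a : unitInterval ≃ₜ unitInterval) := by
  classical
  have mono := strictMono_mem hΓ
  have notone : ¬ AboveIdNearZero 1 := fun ⟨e, he, h⟩ => lt_irrefl _ (h e he le_rfl)
  let P : Γ → Prop := fun a => AboveIdNearZero (a : unitInterval ≃ₜ unitInterval)
  have P1 : ¬ P 1 := notone
  have Pmul : ∀ a b, P a → P b → P (a * b) := fun a b ha hb => ha.mul hb (mono a)
  have Pconj : ∀ a g, P a → P (g * a * g⁻¹) := fun a g ha => ha.conj (mono g)
  have Ptot : ∀ a, a = 1 ∨ P a ∨ P a⁻¹ := fun a => by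
    by_cases h : a = 1
    · exact Or.inl h
    · exact Or.inr (aboveId_or_inv_aboveId (mono a) (hfin a a.2 (by simpa using h)))
  let L : LinearOrder Γ :=
    { le := fun a b => a = b ∨ P (a⁻¹ * b)
      lt := fun a b => P (a⁻¹ * b)
      le_refl := fun a => Or.inl rfl
      le_trans := by
        rintro a b c (rfl | h1) (rfl | h2)
        · exact Or.inl rfl
        · exact Or.inr h2
        · exact Or.inr h1
        · refine Or.inr ?_
          have := Pmul _ _ h1 h2
          rwa [show a⁻¹ * b * (b⁻¹ * c) = a⁻¹ * c by group] at this
      lt_iff_le_not_ge := by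
        intro a b
        refine ⟨fun h => ⟨Or.inr h, ?_⟩, ?_⟩
        · rintro (rfl | h')
          · exact P1 (by simpa using h)
          · have := Pmul _ _ h h'
            rw [show a⁻¹ * b * (b⁻¹ * a) = 1 by group] at this
            exact P1 this
        · rintro ⟨rfl | h1, h2⟩
          · exact absurd (Or.inl rfl) h2
          · exact h1
      le_antisymm := by
        rintro a b (rfl | h1) (h2 | h2)
        · rfl
        · rfl
        · exact h2.symm
        · have := Pmul _ _ h1 h2
          rw [show a⁻¹ * b * (b⁻¹ * a) = 1 by group] at this
          exact absurd this P1
      le_total := by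
        intro a b
        rcases Ptot (a⁻¹ * b) with h | h | h
        · exact Or.inl (Or.inl (inv_mul_eq_one.mp h))
        · exact Or.inl (Or.inr h)
        · exact Or.inr (Or.inr (by simpa using h))
      toDecidableLE := Classical.decRel _ }
  refine ⟨L, ⟨?_⟩, ⟨?_⟩, fun a => ?_⟩
  · rintro a b c (rfl | h)
    · exact Or.inl rfl
    · exact Or.inr (by rwa [show (a * b)⁻¹ * (a * c) = b⁻¹ * c by group])
  · rintro a b c (rfl | h)
    · exact Or.inl rfl
    · refine Or.inr ?_
      have := Pconj _ a⁻¹ h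
      change P ((b * a)⁻¹ * (c * a))
      rwa [show (b * a)⁻¹ * (c * a) = a⁻¹ * (b⁻¹ * c) * a⁻¹⁻¹ by group]
  · change P (1⁻¹ * a) ↔ P a
    simp

variable [LinearOrder Γ] [MulLeftMono Γ]

theorem lt_near_zero (hΓ : Γ ≤ DiffPlusI)
    (hpos : ∀ a : Γ, 1 < a ↔ AboveIdNearZero (a : unitInterval ≃ₜ unitInterval)) {a b : Γ}
    (hab : a < b) : ∃ e : unitInterval, 0 < e ∧ ∀ x, 0 < x → x ≤ e →
      (a : unitInterval ≃ₜ unitInterval) x < (b : unitInterval ≃ₜ unitInterval) x := by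
  obtain ⟨e, he, h⟩ := (hpos (a⁻¹ * b)).mp (by rwa [lt_inv_mul_iff_mul_lt, mul_one])
  refine ⟨e, he, fun x hx0 hx => ?_⟩
  have := strictMono_mem hΓ a (h x hx0 hx)
  simpa using this

/-- If g commutes with f, conjugation by powers of g carries the inequality f ^ n < g from a
neighbourhood of 0 depending on n to one fixed point y. The f-orbit of y is then bounded by g y and
converges to a fixed point where f should be above the identity. -/
theorem not_commute_of_pow_lt (hΓ : Γ ≤ DiffPlusI)
    (hpos : ∀ a : Γ, 1 < a ↔ AboveIdNearZero (a : unitInterval ≃ₜ unitInterval)) {f g : Γ}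
    (hf : 1 < f) (hfg : ∀ n : ℕ, f ^ n < g) : ¬ Commute g f := by
  intro hc
  have mono := strictMono_mem hΓ
  have hg : 1 < g := by simpa using hfg 0
  obtain ⟨a, ha, hfa⟩ := (hpos f).mp hf
  obtain ⟨b, hb, hgb⟩ := (hpos g).mp hg
  set z := min a b
  have hz : 0 < z := lt_min ha hb
  set y := ((g : unitInterval ≃ₜ unitInterval)⁻¹) z with hy
  have hgy : (g : unitInterval ≃ₜ unitInterval) y = z := homeo_apply_inv_self _ _
  have hy0 : 0 < y := homeo_pos (homeo_inv_strictMono (mono g)) hz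
  have bound : ∀ n : ℕ, ((f : unitInterval ≃ₜ unitInterval) ^ n) y ≤ z := by
    intro n
    obtain ⟨d, hd, hdn⟩ := lt_near_zero hΓ hpos (hfg n)
    have hyz : y ≤ z := by
      by_contra! h
      have h1 := mono g h
      rw [hgy] at h1
      exact absurd ((hgb z hz (min_le_right _ _)).trans h1) (lt_irrefl _)
    obtain ⟨k, hk⟩ := exists_lt_pow_apply (mono g) (w := d) (x := y) fun x h1 h2 =>
      hgb x (hd.trans_le h1) ((h2.trans hyz).trans (min_le_right _ _))
    -- The exponent k is large enough that the inverse of q brings y into (0, d], where f ^ n < g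
    -- holds pointwise.
    set q := ((g ^ k : Γ) : unitInterval ≃ₜ unitInterval) with hq
    have mq : StrictMono q := mono (g ^ k)
    have hk' : y < q d := by simpa [hq] using hk
    have h1 : (q⁻¹ : unitInterval ≃ₜ unitInterval) y ≤ d := by
      rw [← mq.le_iff_le]; simpa using hk'.le
    have h2 := mq (hdn _ (homeo_pos (homeo_inv_strictMono mq) hy0) h1)
    have c1 : ∀ p : Γ, Commute (g ^ k) p → q ((p : unitInterval ≃ₜ unitInterval)
        ((q⁻¹ : unitInterval ≃ₜ unitInterval) y)) = (p : unitInterval ≃ₜ unitInterval) y := by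
      intro p hp
      have : g ^ k * p * (g ^ k)⁻¹ = p := by rw [hp.eq, mul_inv_cancel_right]
      exact congrArg (fun r : Γ => (r : unitInterval ≃ₜ unitInterval) y) this
    rw [c1 _ (hc.pow_pow k n), c1 _ ((Commute.refl g).pow_left k), hgy] at h2
    simpa using h2.le
  have hyz : y ≤ z := bound 0
  obtain ⟨c, hc1, hc2, hc3⟩ := exists_fixed_of_iterates_le (mono f)
    (hfa y hy0 (hyz.trans (min_le_left _ _))).le bound
  exact (hfa c (hy0.trans_le hc1) (hc2.trans (min_le_left _ _))).ne' hc3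

variable [MulRightMono Γ]

/-- Otherwise there is a chain of positive elements, each exceeding all powers of the next. Applying
`Oscillates.step` up this chain builds an element with N + 2 oscillations, hence at least N + 1
fixed points. -/
theorem exists_minimal_class (hΓ : Γ ≤ DiffPlusI)
    (hpos : ∀ a : Γ, 1 < a ↔ AboveIdNearZero (a : unitInterval ≃ₜ unitInterval)) {N : ℕ}
    (hfix : ∀ g ∈ Γ, g ≠ 1 → (interiorFixed g).encard ≤ N) (hne : ∃ g : Γ, 1 < g) :
    ∃ f : Γ, 1 < f ∧ ∀ x : Γ, 1 < x → ∃ n : ℕ, f ≤ x ^ n := by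
  by_contra! hcon
  obtain ⟨g, hg⟩ := hne
  choose! t ht1 ht using hcon
  let s : ℕ → Γ := fun i => t^[i] g
  have s1 : ∀ i, 1 < s i := by
    intro i
    induction i with
    | zero => exact hg
    | succ i ih => simpa [s, Function.iterate_succ_apply'] using ht1 _ ih
  have spow : ∀ i n, s (i + 1) ^ n < s i := fun i n => by
    simpa [s, Function.iterate_succ_apply'] using ht _ (s1 i) n
  have anti : StrictAnti s := strictAnti_nat_of_succ_lt fun i => by simpa using spow i 1
  have mono := strictMono_mem hΓ
  have hee : ∀ m : ℕ, ∃ e : unitInterval, 0 < e ∧ ∀ i < m, ∀ y, 0 < y → y ≤ e →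
      y < (s (i + 1) : unitInterval ≃ₜ unitInterval) y ∧
      (s (i + 1) : unitInterval ≃ₜ unitInterval) y < (s 0 : unitInterval ≃ₜ unitInterval) y := by
    intro m
    induction m with
    | zero => exact ⟨1, zero_lt_one, by simp⟩
    | succ m ih =>
      obtain ⟨e, he, h⟩ := ih
      obtain ⟨a, ha, h1⟩ := (hpos _).mp (s1 (m + 1))
      obtain ⟨b, hb, h2⟩ := lt_near_zero hΓ hpos (anti m.succ_pos)
      refine ⟨min e (min a b), lt_min he (lt_min ha hb), fun i hi y hy0 hy => ?_⟩
      rcases Nat.lt_succ_iff_lt_or_eq.mp hi with hi | rfl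
      · exact h i hi y hy0 (hy.trans (min_le_left _ _))
      · exact ⟨h1 y hy0 (hy.trans ((min_le_right _ _).trans (min_le_left _ _))),
          h2 y hy0 (hy.trans ((min_le_right _ _).trans (min_le_right _ _)))⟩
  obtain ⟨e, he, hs⟩ := hee (N + 2)
  -- Going from i + 1 to i trades one unit of strength for one more oscillation. The bound u < s i
  -- keeps s i * u⁻¹ positive for the next stage, and domination of powers in the chain restores it
  -- after the uncontrolled exponent k + 1.
  have key : ∀ j i, i + j = N + 2 → ∃ u : Γ, 1 ≤ u ∧ u < s i ∧ ∃ x, 0 < x ∧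
      Oscillates (s 0 : unitInterval ≃ₜ unitInterval) u (i + 1) e true j x := by
    intro j
    induction j with
    | zero => exact fun i _ => ⟨1, le_rfl, s1 i, 1, zero_lt_one, trivial⟩
    | succ j ih =>
      intro i hij
      obtain ⟨u, hu1, hus, x, hx, H⟩ := ih (i + 1) (by omega)
      have hlt := hs i (by omega)
      have hv1 : 1 < s (i + 1) * u⁻¹ := by rwa [lt_mul_inv_iff_mul_lt, one_mul]
      obtain ⟨k, y, hy, H'⟩ := H.step (mono _) (mono u) (mono (s (i + 1))) he
        (fun y h0 h1 => (hlt y h0 h1).1) (fun y h0 h1 => (hlt y h0 h1).2) hx ((hpos _).mp hv1)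
      refine ⟨(s (i + 1) * u⁻¹) ^ (k + 1), (one_lt_pow' hv1 k.succ_ne_zero).le, ?_, y, hy, H'⟩
      refine lt_of_le_of_lt (pow_le_pow_left' ?_ _) (spow i (k + 1))
      exact mul_le_of_le_one_right' (inv_le_one'.mpr hu1)
  obtain ⟨u, -, -, x, hx, H⟩ := key (N + 2) 0 (by omega)
  obtain ⟨w, hw, hsgn, hr⟩ := H.le_encard (R := 0) (mono _) (mono u) he fun y h0 h1 =>
    ((hs 0 (by omega) y h0 h1).1).trans (hs 0 (by omega) y h0 h1).2
  have hu : (u : unitInterval ≃ₜ unitInterval) ≠ 1 := by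
    intro h
    rw [h] at hsgn
    simp at hsgn
  have hsub : {y | w < y ∧ y < 1 ∧ (u : unitInterval ≃ₜ unitInterval) y = y}
      ⊆ interiorFixed (u : unitInterval ≃ₜ unitInterval) :=
    fun y hy => ⟨(hx.trans hw).trans hy.1, hy.2⟩
  have := (hr.trans (Set.encard_le_encard hsub)).trans (hfix u u.2 hu)
  exact absurd (Nat.cast_le.mp this) (by omega)

end GermOrder

/-! ### Derivatives at the end point 1 -/

section EndpointDerivative

/-- The one-sided derivative at the end point `1`. -/
noncomputable def derivAtOne (f : unitInterval → unitInterval) : ℝ :=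
  derivWithin (fun x : ℝ => (f (Set.projIcc (0 : ℝ) 1 zero_le_one x) : ℝ)) (Set.Icc (0 : ℝ) 1) 1

theorem IsC1OnI.hasDerivWithinAt {f : unitInterval → unitInterval} (hf : IsC1OnI f) {x : ℝ}
    (hx : x ∈ Set.Icc (0 : ℝ) 1) :
    HasDerivWithinAt (fun x : ℝ => (f (Set.projIcc (0 : ℝ) 1 zero_le_one x) : ℝ))
      (derivWithin (fun x : ℝ => (f (Set.projIcc (0 : ℝ) 1 zero_le_one x) : ℝ))
        (Set.Icc (0 : ℝ) 1) x) (Set.Icc (0 : ℝ) 1) x :=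
  (hf.differentiableOn one_ne_zero x hx).hasDerivWithinAt

theorem derivAtOne_id : derivAtOne (fun x => x) = 1 := by
  have h : HasDerivWithinAt
      (fun x : ℝ => ((Set.projIcc (0 : ℝ) 1 zero_le_one x : unitInterval) : ℝ)) 1
      (Set.Icc (0 : ℝ) 1) 1 :=
    (hasDerivWithinAt_id 1 _).congr (fun x hx => by simp [Set.projIcc_of_mem zero_le_one hx])
      (by simp)
  exact h.derivWithin (uniqueDiffOn_Icc zero_lt_one 1 (by simp))

theorem derivAtOne_mul {f g : unitInterval ≃ₜ unitInterval} (hf : f ∈ DiffPlusI)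
    (hg : g ∈ DiffPlusI) : derivAtOne (f * g : unitInterval ≃ₜ unitInterval)
      = derivAtOne f * derivAtOne g := by
  have m1 : (1 : ℝ) ∈ Set.Icc (0 : ℝ) 1 := by simp
  have hg1 : g 1 = 1 := homeo_one hg.1
  have h1 := hf.2.1.hasDerivWithinAt m1
  have h2 := hg.2.1.hasDerivWithinAt m1
  have hv : ((g (Set.projIcc (0 : ℝ) 1 zero_le_one 1) : unitInterval) : ℝ) = 1 := by
    simp [hg1]
  have h3 := HasDerivWithinAt.comp_of_eq (1 : ℝ) h1 h2 (fun x _ => (g _).2) hv.symm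
  refine HasDerivWithinAt.derivWithin (h3.congr (fun x _ => ?_) ?_)
    (uniqueDiffOn_Icc zero_lt_one 1 m1)
  · simp only [Function.comp, Set.projIcc_val]; rfl
  · simp only [Function.comp, Set.projIcc_val]; rfl

theorem derivAtOne_mul_inv {f : unitInterval ≃ₜ unitInterval} (hf : f ∈ DiffPlusI) :
    derivAtOne f * derivAtOne (f⁻¹ : unitInterval ≃ₜ unitInterval) = 1 := by
  rw [← derivAtOne_mul hf (DiffPlusI.inv_mem hf), mul_inv_cancel]
  exact derivAtOne_id

theorem derivAtOne_pos {f : unitInterval ≃ₜ unitInterval} (hf : f ∈ DiffPlusI) :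
    0 < derivAtOne f := by
  have h0 : derivAtOne f ≠ 0 := left_ne_zero_of_mul_eq_one (derivAtOne_mul_inv hf)
  refine lt_of_le_of_ne ?_ h0.symm
  refine MonotoneOn.derivWithin_nonneg fun x _ y _ hxy => ?_
  exact hf.1.monotone (Set.monotone_projIcc zero_le_one hxy)

theorem derivAtOne_commutator {f g : unitInterval ≃ₜ unitInterval} (hf : f ∈ DiffPlusI)
    (hg : g ∈ DiffPlusI) :
    derivAtOne (f * g * f⁻¹ * g⁻¹ : unitInterval ≃ₜ unitInterval) = 1 := by
  have hf' := DiffPlusI.inv_mem hf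
  have hg' := DiffPlusI.inv_mem hg
  rw [derivAtOne_mul (DiffPlusI.mul_mem (DiffPlusI.mul_mem hf hg) hf') hg',
    derivAtOne_mul (DiffPlusI.mul_mem hf hg) hf', derivAtOne_mul hf hg]
  have h1 := derivAtOne_mul_inv hf
  have h2 := derivAtOne_mul_inv hg
  linear_combination derivAtOne g * derivAtOne (g⁻¹ : unitInterval ≃ₜ unitInterval) * h1 + h2

/-- By continuity of the derivative at 1, the mean value inequality applies to f minus its linear
part with constant η. -/
theorem exists_bounds_near_one {f : unitInterval ≃ₜ unitInterval} (hf : f ∈ DiffPlusI) {η : ℝ}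
    (hη : 0 < η) : ∃ c : unitInterval, c < 1 ∧ ∀ x y : unitInterval, c ≤ x → x ≤ y →
      (derivAtOne f - η) * ((y : ℝ) - x) ≤ (f y : ℝ) - f x ∧
      (f y : ℝ) - f x ≤ (derivAtOne f + η) * ((y : ℝ) - x) := by
  set F : ℝ → ℝ := fun x : ℝ => (f (Set.projIcc (0 : ℝ) 1 zero_le_one x) : ℝ) with hF
  have m1 : (1 : ℝ) ∈ Set.Icc (0 : ℝ) 1 := by simp
  have cont : ContinuousOn (derivWithin F (Set.Icc 0 1)) (Set.Icc 0 1) :=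
    hf.2.1.continuousOn_derivWithin (uniqueDiffOn_Icc zero_lt_one) le_rfl
  obtain ⟨δ, hδ, h⟩ := Metric.continuousWithinAt_iff.mp (cont 1 m1) η hη
  set c : ℝ := max 0 (1 - δ / 2) with hc
  have hc0 : 0 ≤ c := le_max_left _ _
  have hc1 : c < 1 := max_lt zero_lt_one (by linarith)
  have hcδ : 1 - δ / 2 ≤ c := le_max_right _ _
  have sub : Set.Icc c 1 ⊆ Set.Icc 0 1 := Set.Icc_subset_Icc_left hc0
  refine ⟨⟨c, hc0, hc1.le⟩, by exact_mod_cast hc1, fun x y hx hxy => ?_⟩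
  have hx' : (x : ℝ) ∈ Set.Icc c 1 := ⟨hx, x.2.2⟩
  have hy' : (y : ℝ) ∈ Set.Icc c 1 := ⟨hx.trans hxy, y.2.2⟩
  have key := Convex.norm_image_sub_le_of_norm_hasDerivWithin_le
    (f := fun t => F t - derivAtOne f * t)
    (f' := fun t => derivWithin F (Set.Icc 0 1) t - derivAtOne f * 1)
    (s := Set.Icc c 1) (C := η)
    (fun t ht => ((hf.2.1.hasDerivWithinAt (sub ht)).mono sub).sub
      ((hasDerivWithinAt_id t _).const_mul _))
    (fun t ht => by
      have h1 := h (sub ht) (by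
        rw [Real.dist_eq, abs_lt]; constructor <;> linarith [ht.1, ht.2])
      rw [mul_one, ← dist_eq_norm]
      exact h1.le)
    (convex_Icc c 1) hx' hy'
  have e1 : F x = f x := by simp [hF]
  have e2 : F y = f y := by simp [hF]
  have hxy' : (0 : ℝ) ≤ y - x := sub_nonneg.mpr hxy
  rw [e1, e2, Real.norm_eq_abs, Real.norm_eq_abs, abs_of_nonneg hxy', abs_le] at key
  constructor <;> nlinarith [key.1, key.2]

end EndpointDerivative

/-! ### Freeness of the translation subgroup -/

section FreeAction

/-- A point moved by an increasing map has a strictly monotone, hence infinite, orbit. -/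
theorem eq_self_of_finite_invariant {g : unitInterval ≃ₜ unitInterval} (mg : StrictMono g)
    {s : Set unitInterval} (hs : s.Finite) (hg : ∀ x ∈ s, g x ∈ s) {x : unitInterval}
    (hx : x ∈ s) : g x = x := by
  have mem : ∀ n : ℕ, (g ^ n) x ∈ s := by
    intro n
    induction n with
    | zero => exact hx
    | succ n ih => rw [homeo_pow_succ]; exact hg _ ih
  rcases lt_trichotomy (g x) x with h | h | h
  · refine absurd hs (Set.infinite_of_injective_forall_mem (f := fun n : ℕ => (g ^ n) x) ?_ mem)
    refine (strictAnti_nat_of_succ_lt fun n => ?_).injective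
    rw [homeo_pow_succ_apply]
    exact homeo_pow_strictMono mg n h
  · exact h
  · refine absurd hs (Set.infinite_of_injective_forall_mem (f := fun n : ℕ => (g ^ n) x) ?_ mem)
    refine (strictMono_nat_of_lt_succ fun n => ?_).injective
    rw [homeo_pow_succ_apply]
    exact homeo_pow_strictMono mg n h

variable {Γ : Subgroup (unitInterval ≃ₜ unitInterval)} [LinearOrder Γ]
  (D : TranslationData Γ)

/-- K is commutative, so it preserves the finite fixed set of k and fixes it pointwise. Conjugates
of k lie in K and fix these points too, so all of Γ preserves the set and hence fixes it pointwise,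
against irreducibility. -/
theorem TranslationData.interiorFixed_eq_empty (hΓ : Γ ≤ DiffPlusI) (hirr : IsIrreducibleOnI Γ)
    (hfin : ∀ g ∈ Γ, g ≠ 1 → (interiorFixed g).Finite) {k : Γ} (hk : k ∈ D.K) (hk1 : k ≠ 1) :
    interiorFixed (k : unitInterval ≃ₜ unitInterval) = ∅ := by
  by_contra hne
  obtain ⟨x, hx⟩ := Set.nonempty_iff_ne_empty.mpr hne
  have mono := strictMono_mem hΓ
  have fin := hfin k k.2 (by simpa using hk1)
  have app : ∀ {a b : Γ}, a = b → ∀ y, (a : unitInterval ≃ₜ unitInterval) y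
      = (b : unitInterval ≃ₜ unitInterval) y := fun h y => by rw [h]
  have step : ∀ l ∈ D.K, ∀ y ∈ interiorFixed (k : unitInterval ≃ₜ unitInterval),
      (l : unitInterval ≃ₜ unitInterval) y = y := by
    intro l hl y hy
    refine eq_self_of_finite_invariant (mono l) fin (fun z hz => ?_) hy
    refine ⟨homeo_pos (mono l) hz.1, homeo_lt_one (mono l) hz.2.1, ?_⟩
    have h1 := app (D.commute hk hl).eq z
    change (k : unitInterval ≃ₜ unitInterval) ((l : unitInterval ≃ₜ unitInterval) z) =
      (l : unitInterval ≃ₜ unitInterval) ((k : unitInterval ≃ₜ unitInterval) z) at h1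
    rw [h1, hz.2.2]
  refine hirr ⟨x, hx.1, hx.2.1, fun g hg => ?_⟩
  refine eq_self_of_finite_invariant (hΓ hg).1 fin (fun y hy => ?_) hx
  refine ⟨homeo_pos (hΓ hg).1 hy.1, homeo_lt_one (hΓ hg).1 hy.2.1, ?_⟩
  have h1 := step _ (D.conj_mem (⟨g, hg⟩⁻¹ : Γ) k hk) y hy
  have h2 : (g⁻¹ : unitInterval ≃ₜ unitInterval) ((k : unitInterval ≃ₜ unitInterval)
      ((g⁻¹⁻¹ : unitInterval ≃ₜ unitInterval) y)) = y := h1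
  rw [inv_inv] at h2
  conv_rhs => rw [← h2]
  exact (homeo_apply_inv_self _ _).symm

theorem TranslationData.lt_apply (hΓ : Γ ≤ DiffPlusI) (hirr : IsIrreducibleOnI Γ)
    (hpos : ∀ a : Γ, 1 < a ↔ AboveIdNearZero (a : unitInterval ≃ₜ unitInterval))
    (hfin : ∀ g ∈ Γ, g ≠ 1 → (interiorFixed g).Finite) {k : Γ} (hk : k ∈ D.K) (hk1 : 1 < k)
    {x : unitInterval} (hx0 : 0 < x) (hx1 : x < 1) :
    x < (k : unitInterval ≃ₜ unitInterval) x := by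
  by_contra! h
  obtain ⟨e, he, hke⟩ := (hpos k).mp hk1
  have hmin : 0 < min e x := lt_min he hx0
  obtain ⟨c, hc1, hc2, hc3⟩ := exists_fixed_of_le_of_le (min_le_right e x)
    (Or.inl ⟨(hke _ hmin (min_le_left _ _)).le, h⟩)
  have : c ∈ interiorFixed (k : unitInterval ≃ₜ unitInterval) :=
    ⟨hmin.trans_le hc1, hc2.trans_lt hx1, hc3⟩
  rw [D.interiorFixed_eq_empty hΓ hirr hfin hk hk1.ne'] at this
  exact this

end FreeAction

/-! ### At most one fixed point outside the translation subgroup -/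

section FixedPointBound

variable {Γ : Subgroup (unitInterval ≃ₜ unitInterval)} [LinearOrder Γ] [MulLeftMono Γ]
  (D : TranslationData Γ)

theorem TranslationData.apply_lt_apply
    (hlt : ∀ k ∈ D.K, 1 < k → ∀ x : unitInterval, 0 < x → x < 1 →
      x < (k : unitInterval ≃ₜ unitInterval) x)
    (hΓ : Γ ≤ DiffPlusI) {k l : Γ} (hk : k ∈ D.K) (hl : l ∈ D.K) (h : k < l) {x : unitInterval}
    (hx0 : 0 < x) (hx1 : x < 1) :
    (k : unitInterval ≃ₜ unitInterval) x < (l : unitInterval ≃ₜ unitInterval) x := by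
  have h1 := hlt (k⁻¹ * l) (D.K.mul_mem (D.K.inv_mem hk) hl)
    (by rwa [lt_inv_mul_iff_mul_lt, mul_one]) x hx0 hx1
  simpa using strictMono_mem hΓ k h1

theorem pow_apply_eq_self {g : unitInterval ≃ₜ unitInterval} {x : unitInterval} (h : g x = x)
    (n : ℕ) : (g ^ n) x = x := by
  induction n with
  | zero => rfl
  | succ n ih => rw [homeo_pow_succ, ih, h]

theorem inv_apply_eq_self {g : unitInterval ≃ₜ unitInterval} {x : unitInterval} (h : g x = x) :
    (g⁻¹ : unitInterval ≃ₜ unitInterval) x = x := by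
  conv_lhs => rw [← h]
  exact homeo_inv_apply_self g x

/-- If k a < b, then every conjugate of k by a power of g also sends a below b, because g fixes both
points. But these conjugates have unbounded τ and eventually exceed a power of k that moves a past
b. -/
theorem TranslationData.le_apply_of_fixed
    (hlt : ∀ k ∈ D.K, 1 < k → ∀ x : unitInterval, 0 < x → x < 1 →
      x < (k : unitInterval ≃ₜ unitInterval) x)
    (hΓ : Γ ≤ DiffPlusI) {g : Γ} (hg : 1 < D.mult g) {a b : unitInterval} (ha : 0 < a)
    (hab : a < b) (hb : b < 1) (hga : (g : unitInterval ≃ₜ unitInterval) a = a)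
    (hgb : (g : unitInterval ≃ₜ unitInterval) b = b) {k : Γ} (hk : k ∈ D.K) (hk1 : 1 < k) :
    b ≤ (k : unitInterval ≃ₜ unitInterval) a := by
  by_contra! hcon
  have mono := strictMono_mem hΓ
  have kpos : 0 < D.tau k := D.tau_one ▸ D.tau_lt 1 D.K.one_mem k hk hk1
  obtain ⟨j, hj⟩ := exists_lt_pow_apply (mono k) (w := a) (x := b) fun y h1 h2 =>
    hlt k hk hk1 y (ha.trans_le h1) (h2.trans_lt hb)
  obtain ⟨n, hn⟩ := pow_unbounded_of_one_lt (j : ℝ) hg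
  have hK := D.conj_mem (g ^ n) k hk
  have h1 : k ^ j < g ^ n * k * (g ^ n)⁻¹ := by
    rw [← D.tau_lt_iff (D.K.pow_mem hk j) hK, D.tau_conj _ k hk, D.tau_pow hk, D.mult_pow]
    exact mul_lt_mul_of_pos_right hn kpos
  have h2 := D.apply_lt_apply hlt hΓ (D.K.pow_mem hk j) hK h1 ha (hab.trans hb)
  have h3 : ((g : unitInterval ≃ₜ unitInterval) ^ n) ((k : unitInterval ≃ₜ unitInterval)
      (((g : unitInterval ≃ₜ unitInterval) ^ n)⁻¹ a)) < b := by
    rw [inv_apply_eq_self (pow_apply_eq_self hga n)]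
    have := homeo_pow_strictMono (mono g) n hcon
    rwa [pow_apply_eq_self hgb n] at this
  have h4 : ((k : unitInterval ≃ₜ unitInterval) ^ j) a <
      ((g : unitInterval ≃ₜ unitInterval) ^ n) ((k : unitInterval ≃ₜ unitInterval)
      (((g : unitInterval ≃ₜ unitInterval) ^ n)⁻¹ a)) := h2
  exact lt_asymm hj (h4.trans h3)

/-- The elements `k ^ e₀ * (g k g⁻¹) ^ e₁ * ⋯ * (gⁿ k ^ (i + e) g⁻ⁿ)`, enumerated by the binary
digits of `j`. -/
def digitElement (g k : Γ) (i : ℕ) : ℕ → ℕ → Γ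
  | 0, j => k ^ (i + j)
  | n + 1, j => k ^ (j % 2) * (g * digitElement g k i n (j / 2) * g⁻¹)

omit [MulLeftMono Γ] in
theorem TranslationData.digitElement_mem {g k : Γ} (hk : k ∈ D.K) (i n j : ℕ) :
    digitElement g k i n j ∈ D.K := by
  induction n generalizing j with
  | zero => exact D.K.pow_mem hk _
  | succ n ih => exact D.K.mul_mem (D.K.pow_mem hk _) (D.conj_mem g _ (ih _))

omit [MulLeftMono Γ] in
theorem TranslationData.tau_digitElement_succ {g k : Γ} (hk : k ∈ D.K) (i n j : ℕ) :
    D.tau (digitElement g k i (n + 1) j) =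
      (j % 2 : ℕ) * D.tau k + D.mult g * D.tau (digitElement g k i n (j / 2)) := by
  rw [digitElement, D.tau_mul _ (D.K.pow_mem hk _) _ (D.conj_mem g _ (D.digitElement_mem hk i n _)),
    D.tau_pow hk, D.tau_conj g _ (D.digitElement_mem hk i n _)]

omit [MulLeftMono Γ] in
-- When the last digit carries, τ k is lost but at least `mult g` * τ k is gained; this is where
-- `mult g` ≥ 2 enters.
theorem TranslationData.tau_digitElement_add_le {g k : Γ} (hk : k ∈ D.K) (hk1 : 0 ≤ D.tau k)
    (hg : 2 ≤ D.mult g) (i n j : ℕ) :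
    D.tau (digitElement g k i n j) + D.tau k ≤ D.tau (digitElement g k i n (j + 1)) := by
  induction n generalizing j with
  | zero =>
    rw [digitElement, digitElement, D.tau_pow hk, D.tau_pow hk]
    push_cast
    linarith
  | succ n ih =>
    rw [D.tau_digitElement_succ hk, D.tau_digitElement_succ hk]
    rcases Nat.even_or_odd' j with ⟨l, rfl | rfl⟩
    · rw [show (2 * l + 1) % 2 = 1 by omega, show (2 * l + 1) / 2 = l by omega,
        show (2 * l) % 2 = 0 by omega, show (2 * l) / 2 = l by omega]
      push_cast
      linarith
    · rw [show (2 * l + 1 + 1) % 2 = 0 by omega, show (2 * l + 1 + 1) / 2 = l + 1 by omega,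
        show (2 * l + 1) % 2 = 1 by omega, show (2 * l + 1) / 2 = l by omega]
      have := ih l
      push_cast
      nlinarith

omit [MulLeftMono Γ] in
theorem TranslationData.le_tau_digitElement {g k : Γ} (hk : k ∈ D.K) (hk1 : 0 ≤ D.tau k)
    (hg : 2 ≤ D.mult g) (i n j : ℕ) :
    i * D.tau k ≤ D.tau (digitElement g k i n j) := by
  induction n generalizing j with
  | zero =>
    rw [digitElement, D.tau_pow hk]
    gcongr
    omega
  | succ n ih =>
    rw [D.tau_digitElement_succ hk]
    have h1 := ih (j / 2)
    have h2 : (0 : ℝ) ≤ i * D.tau k := by positivity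
    have h3 : (0 : ℝ) ≤ (j % 2 : ℕ) * D.tau k := by positivity
    nlinarith

/-- A counting argument on lengths: near 1, both g and k are almost linear, with slopes τ and 1. The
2^n images of [a,b] each have length of order at least (0.81 τ)^n, yet lie in an interval of length
of order at most (1.1 τ)^n. -/
theorem TranslationData.eq_of_fixed
    (hlt : ∀ k ∈ D.K, 1 < k → ∀ x : unitInterval, 0 < x → x < 1 →
      x < (k : unitInterval ≃ₜ unitInterval) x)
    (hΓ : Γ ≤ DiffPlusI) {g : Γ} (hg : 2 ≤ D.mult g) {a b : unitInterval} (ha : 0 < a)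
    (hab : a < b) (hb : b < 1) (hga : (g : unitInterval ≃ₜ unitInterval) a = a)
    (hgb : (g : unitInterval ≃ₜ unitInterval) b = b) : False := by
  have mono := strictMono_mem hΓ
  have ha1 : a < 1 := hab.trans hb
  have hb0 : 0 < b := ha.trans hab
  obtain ⟨f, hf, hf1⟩ := D.exists_one_lt
  have fpos : 0 < D.tau f := D.tau_one ▸ D.tau_lt 1 D.K.one_mem f hf hf1
  -- A commutator has derivative 1 at the end point, and this one is positive because its τ-value is
  -- (`mult g` - 1) * τ f.
  set k : Γ := g * f * g⁻¹ * f⁻¹ with hkdef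
  have hk : k ∈ D.K := D.commutator_mem g f
  have kpos : 0 < D.tau k := by
    rw [hkdef, D.tau_mul _ (D.conj_mem g f hf) _ (D.K.inv_mem hf), D.tau_conj g f hf, D.tau_inv hf]
    nlinarith
  have hk1 : 1 < k := by rwa [← D.tau_lt_iff D.K.one_mem hk, D.tau_one]
  have kder : derivAtOne (k : unitInterval ≃ₜ unitInterval) = 1 :=
    derivAtOne_commutator (hΓ g.2) (hΓ f.2)
  set τ := derivAtOne (g : unitInterval ≃ₜ unitInterval) with hτ
  have τpos : 0 < τ := derivAtOne_pos (hΓ g.2)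
  obtain ⟨c₁, hc₁, hbg⟩ := exists_bounds_near_one (hΓ g.2) (η := τ / 10) (by positivity)
  obtain ⟨c₂, hc₂, hbk⟩ := exists_bounds_near_one (hΓ k.2) (η := 1 / 10) (by norm_num)
  rw [kder] at hbk
  set c := max c₁ c₂ with hc
  have hc1 : c < 1 := max_lt hc₁ hc₂
  -- The offset i puts every image of a beyond c, so that the derivative bounds apply to all the
  -- intervals at once.
  obtain ⟨i, hi⟩ := exists_lt_pow_apply (mono k) (w := a) (x := c) fun y h1 h2 =>
    hlt k hk hk1 y (ha.trans_le h1) (h2.trans_lt hc1)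
  let X : ℕ → ℕ → Γ := digitElement g k i
  have XK : ∀ n j, X n j ∈ D.K := D.digitElement_mem hk i
  let A : ℕ → ℕ → unitInterval := fun n j => (X n j : unitInterval ≃ₜ unitInterval) a
  let B : ℕ → ℕ → unitInterval := fun n j => (X n j : unitInterval ≃ₜ unitInterval) b
  have hAB : ∀ n j, A n j ≤ B n j := fun n j => (mono _ hab).le
  have hBA : ∀ n j, B n j ≤ A n (j + 1) := by
    intro n j
    have h1 : X n j < X n (j + 1) := by
      rw [← D.tau_lt_iff (XK _ _) (XK _ _)]
      have := D.tau_digitElement_add_le hk kpos.le hg i n j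
      exact lt_of_lt_of_le (by linarith) this
    have h2 := D.le_apply_of_fixed hlt hΓ (by linarith) ha hab hb hga hgb
      (D.K.mul_mem (D.K.inv_mem (XK n j)) (XK n (j + 1)))
      (by rwa [lt_inv_mul_iff_mul_lt, mul_one])
    have h3 := (mono (X n j)).monotone h2
    simpa using h3
  have hcA : ∀ n j, c ≤ A n j := by
    intro n j
    have h1 : k ^ i ≤ X n j := by
      by_contra! h
      have h2 := D.tau_lt _ (XK n j) _ (D.K.pow_mem hk i) h
      rw [D.tau_pow hk] at h2
      exact absurd h2 (not_lt.mpr (D.le_tau_digitElement hk kpos.le hg i n j))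
    rcases h1.eq_or_lt with h1 | h1
    · change c ≤ (X n j : unitInterval ≃ₜ unitInterval) a
      rw [← h1]
      exact hi.le
    · exact hi.le.trans (D.apply_lt_apply hlt hΓ (D.K.pow_mem hk i) (XK n j) h1 ha ha1).le
  have hfix : ∀ x : unitInterval, (g : unitInterval ≃ₜ unitInterval) x = x → ∀ n j,
      ((g * X n j * g⁻¹ : Γ) : unitInterval ≃ₜ unitInterval) x =
      (g : unitInterval ≃ₜ unitInterval) ((X n j : unitInterval ≃ₜ unitInterval) x) := by
    intro x hx n j
    change (g : unitInterval ≃ₜ unitInterval) ((X n j : unitInterval ≃ₜ unitInterval)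
      ((g : unitInterval ≃ₜ unitInterval)⁻¹ x)) = _
    rw [inv_apply_eq_self hx]
  have heven : ∀ x : unitInterval, (g : unitInterval ≃ₜ unitInterval) x = x → ∀ n l,
      (X (n + 1) (2 * l) : unitInterval ≃ₜ unitInterval) x =
      (g : unitInterval ≃ₜ unitInterval) ((X n l : unitInterval ≃ₜ unitInterval) x) := by
    intro x hx n l
    have : X (n + 1) (2 * l) = g * X n l * g⁻¹ := by
      simp only [X, digitElement]
      rw [show (2 * l) % 2 = 0 by omega, show (2 * l) / 2 = l by omega, pow_zero, one_mul]
    rw [this, hfix x hx]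
  have hodd : ∀ x : unitInterval, (g : unitInterval ≃ₜ unitInterval) x = x → ∀ n l,
      (X (n + 1) (2 * l + 1) : unitInterval ≃ₜ unitInterval) x =
      (k : unitInterval ≃ₜ unitInterval)
        ((X (n + 1) (2 * l) : unitInterval ≃ₜ unitInterval) x) := by
    intro x hx n l
    have : X (n + 1) (2 * l + 1) = k * X (n + 1) (2 * l) := by
      simp only [X, digitElement]
      rw [show (2 * l) % 2 = 0 by omega, show (2 * l) / 2 = l by omega,
        show (2 * l + 1) % 2 = 1 by omega, show (2 * l + 1) / 2 = l by omega, pow_zero, one_mul,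
        pow_one]
    rw [this]
    rfl
  set L : ℝ := (B 0 0 : ℝ) - A 0 0 with hL
  have Lpos : 0 < L := sub_pos.mpr (mono (X 0 0) hab)
  set U : ℝ := (A 0 1 : ℝ) - A 0 0 with hU
  -- Both indices at level n + 1 are even, so the enclosing interval is the g-image of the one at
  -- level n.
  have upper : ∀ n, (A n (2 ^ n) : ℝ) - A n 0 ≤ (11 / 10 * τ) ^ n * U := by
    intro n
    induction n with
    | zero => simp [hU]
    | succ n ih =>
      have e1 : A (n + 1) (2 ^ (n + 1)) = (g : unitInterval ≃ₜ unitInterval) (A n (2 ^ n)) := by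
        rw [pow_succ']; exact heven a hga n _
      have e2 : A (n + 1) 0 = (g : unitInterval ≃ₜ unitInterval) (A n 0) := heven a hga n 0
      have hmono : A n 0 ≤ A n (2 ^ n) :=
        monotone_nat_of_le_succ (fun j => (hAB n j).trans (hBA n j)) (Nat.zero_le _)
      have h1 := (hbg _ _ ((le_max_left _ _).trans (hcA n 0)) hmono).2
      rw [e1, e2, pow_succ]
      calc _ ≤ (τ + τ / 10) * ((A n (2 ^ n) : ℝ) - A n 0) := h1
        _ ≤ (τ + τ / 10) * ((11 / 10 * τ) ^ n * U) := by gcongr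
        _ = _ := by ring
  -- Each level applies g once and k at most once, losing at most the factors 9/10 * τ and 9/10.
  have lower : ∀ n, ∀ j < 2 ^ n, (81 / 100 * τ) ^ n * L ≤ (B n j : ℝ) - A n j := by
    intro n
    induction n with
    | zero =>
      intro j hj
      obtain rfl : j = 0 := by simpa using hj
      simp [hL]
    | succ n ih =>
      intro j hj
      rw [pow_succ'] at hj
      have ev : ∀ l < 2 ^ n, 9 / 10 * τ * ((81 / 100 * τ) ^ n * L) ≤
          (B (n + 1) (2 * l) : ℝ) - A (n + 1) (2 * l) := by
        intro l hl
        have e1 : A (n + 1) (2 * l) = (g : unitInterval ≃ₜ unitInterval) (A n l) := heven a hga n l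
        have e2 : B (n + 1) (2 * l) = (g : unitInterval ≃ₜ unitInterval) (B n l) := heven b hgb n l
        have h1 := (hbg _ _ ((le_max_left _ _).trans (hcA n l)) (hAB n l)).1
        rw [e1, e2]
        calc 9 / 10 * τ * ((81 / 100 * τ) ^ n * L)
            ≤ 9 / 10 * τ * ((B n l : ℝ) - A n l) := by gcongr; exact ih l hl
          _ = (τ - τ / 10) * ((B n l : ℝ) - A n l) := by ring
          _ ≤ _ := h1
      have hp : 0 ≤ τ * ((81 / 100 * τ) ^ n * L) := by positivity
      rcases Nat.even_or_odd' j with ⟨l, rfl | rfl⟩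
      · have h1 := ev l (by omega)
        rw [pow_succ]
        linarith
      · have h1 := ev l (by omega)
        have e1 : A (n + 1) (2 * l + 1) =
          (k : unitInterval ≃ₜ unitInterval) (A (n + 1) (2 * l)) := hodd a hga n l
        have e2 : B (n + 1) (2 * l + 1) =
          (k : unitInterval ≃ₜ unitInterval) (B (n + 1) (2 * l)) := hodd b hgb n l
        have h2 := (hbk _ _ ((le_max_right _ _).trans (hcA (n + 1) (2 * l)))
          (hAB (n + 1) (2 * l))).1
        rw [e1, e2, pow_succ]
        linarith
  have total : ∀ n, 2 ^ n * ((81 / 100 * τ) ^ n * L) ≤ (11 / 10 * τ) ^ n * U := by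
    intro n
    calc 2 ^ n * ((81 / 100 * τ) ^ n * L)
        = ∑ j ∈ Finset.range (2 ^ n), (81 / 100 * τ) ^ n * L := by simp
      _ ≤ ∑ j ∈ Finset.range (2 ^ n), ((A n (j + 1) : ℝ) - A n j) := by
          refine Finset.sum_le_sum fun j hj => ?_
          have h1 := lower n j (Finset.mem_range.mp hj)
          have h2 : (B n j : ℝ) ≤ A n (j + 1) := hBA n j
          linarith
      _ = (A n (2 ^ n) : ℝ) - A n 0 := Finset.sum_range_sub (fun j => (A n j : ℝ)) _
      _ ≤ _ := upper n
  -- The ratio is 2 * (81/100) divided by 11/10; the slope τ cancels.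
  obtain ⟨n, hn⟩ := pow_unbounded_of_one_lt (U / L) (show (1 : ℝ) < 162 / 110 by norm_num)
  rw [div_lt_iff₀ Lpos] at hn
  have h1 := total n
  have h2 : (2 : ℝ) ^ n * ((81 / 100 * τ) ^ n * L) =
      (11 / 10 * τ) ^ n * ((162 / 110) ^ n * L) := by
    rw [← mul_assoc, ← mul_assoc, ← mul_pow, ← mul_pow]
    congr 2
    ring
  rw [h2] at h1
  exact absurd (le_of_mul_le_mul_left h1 (by positivity)) (not_le.mpr hn)

theorem TranslationData.encard_interiorFixed_le_one
    (hlt : ∀ k ∈ D.K, 1 < k → ∀ x : unitInterval, 0 < x → x < 1 →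
      x < (k : unitInterval ≃ₜ unitInterval) x)
    (hΓ : Γ ≤ DiffPlusI) {g : Γ} (hg : D.mult g ≠ 1) :
    (interiorFixed (g : unitInterval ≃ₜ unitInterval)).encard ≤ 1 := by
  have key : ∀ h : Γ, 1 < D.mult h → ∀ a b : unitInterval, 0 < a → a < b → b < 1 →
      (h : unitInterval ≃ₜ unitInterval) a = a → (h : unitInterval ≃ₜ unitInterval) b = b →
      False := by
    intro h hh a b ha hab hb hha hhb
    obtain ⟨n, hn⟩ := pow_unbounded_of_one_lt 2 hh
    exact D.eq_of_fixed hlt hΓ (g := h ^ n) (by rw [D.mult_pow]; exact hn.le) ha hab hb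
      (pow_apply_eq_self hha n) (pow_apply_eq_self hhb n)
  have key2 : ∀ a b : unitInterval, 0 < a → a < b → b < 1 →
      (g : unitInterval ≃ₜ unitInterval) a = a → (g : unitInterval ≃ₜ unitInterval) b = b →
      False := by
    intro a b ha hab hb hga hgb
    rcases lt_or_gt_of_ne hg with h | h
    · exact key g⁻¹ (by rw [D.mult_inv]; exact (one_lt_inv₀ (D.mult_pos g)).mpr h) a b ha hab hb
        (inv_apply_eq_self hga) (inv_apply_eq_self hgb)
    · exact key g h a b ha hab hb hga hgb
  rw [Set.encard_le_one_iff]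
  rintro a b ⟨ha0, ha1, ha⟩ ⟨hb0, hb1, hb⟩
  rcases lt_trichotomy a b with h | h | h
  · exact (key2 a b ha0 h hb1 ha hb).elim
  · exact h
  · exact (key2 b a hb0 h ha1 hb ha).elim

end FixedPointBound

theorem theorem1p1 (N : ℕ) (Γ : Subgroup (unitInterval ≃ₜ unitInterval))
    (hΓ : Γ ≤ DiffPlusI) (hirr : IsIrreducibleOnI Γ)
    (hfix : ∀ g ∈ Γ, g ≠ 1 → {x : unitInterval | 0 < x ∧ x < 1 ∧ g x = x}.encard ≤ N) :
    (∃ H : Subgroup (ℝ ≃ₜ ℝ), H ≤ AffPlus ∧ Nonempty (Γ ≃* H)) ∧ Γ ∈ PhiDiff 1 := by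
  have hfin : ∀ g ∈ Γ, g ≠ 1 → (interiorFixed g).Finite := fun g hg h1 =>
    Set.finite_of_encard_le_coe (hfix g hg h1)
  obtain ⟨hL, _, _, hpos⟩ := exists_germ_order hΓ hfin
  -- The trivial group fixes every interior point, so irreducibility rules it out.
  have hne : ∃ g : Γ, 1 < g := by
    by_contra! h
    obtain ⟨x, hx0, hx1⟩ := exists_between (zero_lt_one (α := unitInterval))
    refine hirr ⟨x, hx0, hx1, fun g hg => ?_⟩
    have h1 : (⟨g, hg⟩ : Γ) = 1 := le_antisymm (h _) (by simpa using h ⟨g, hg⟩⁻¹)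
    have h2 : g = 1 := congrArg Subtype.val h1
    rw [h2]
    rfl
  obtain ⟨f, hf, hmin⟩ := exists_minimal_class hΓ hpos hfix hne
  obtain ⟨D⟩ := exists_translationData hf hmin fun g => not_commute_of_pow_lt hΓ hpos hf
  refine ⟨D.exists_mulEquiv_le_affPlus, hΓ, fun g hg h1 => ?_⟩
  by_cases hm : D.mult (⟨g, hg⟩ : Γ) = 1
  · have h2 := D.interiorFixed_eq_empty hΓ hirr hfin (D.mem_of_mult_eq_one _ hm)
      (by simpa [Subtype.ext_iff] using h1)
    change (interiorFixed g).encard ≤ _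
    rw [show interiorFixed g = ∅ from h2]
    simp
  · exact D.encard_interiorFixed_le_one
      (fun k hk hk1 x hx0 hx1 => D.lt_apply hΓ hirr hpos hfin hk hk1 hx0 hx1) hΓ hm
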